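/- **Setting.** Fix $\alpha\in\mathbb C$ and an integer $k\ge 0$. The times $\mathbf t=(t_0,t_1,t_2,\dots)$, with $x=t_0$, range over an open subset $T$ of a complex Banach space of sequences which has continuous coordinates, contains $(1,0,0,\dots)$, and on which $\sum_n t_nz^n$ converges for all $z$ (for example finitely many times, or all sequences with $\sum n!\,|t_n|<\infty$). For functions of $(p,\mathbf t)$ write $\{L,M\}=L_pM_x-L_xM_p$. For a function $g$ of $p$ near $p=\infty$, $(g)_-=0$ means that the Laurent expansion of $g$ at $p=\infty$ contains no negative powers of $p$. *Dressing scheme.* Let $\mathbf F$ be a holomorphic local diffeomorphism of the plane $\mathbb C^2$ given on an open set $U$ (the dressing data). A solution of the Riemann problem on $T$ with data $\mathbf F$ consists of functions $L_{in},M_{in}$, analytic for $|p|\le 1$, $\mathbf t\in T$, and $L_{out},M_{out}$, analytic for $1\le|p|<\infty$, $\mathbf t\in T$, with $$L_{out}=p+\sum_{n\ge1}u_n(\mathbf t)p^{-n},\qquad M_{out}=\sum_{n\ge0}t_nL_{out}^n+\sum_{n\ge1}\tilde v_n(\mathbf t)p^{-n}\qquad(|p|\ge 1),$$ such that $(L_{out},M_{out})\in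 U$ and $(L_{in},M_{in})=\mathbf F(L_{out},M_{out})$ for $|p|=1$, $\mathbf t\in T$. Call it nondegenerate if $\{L_{in},M_{in}\}\ne0$ for $|p|\le1$, $\mathbf t\in T$. Put $J=\{L_{out},M_{out}\}$ (so $J=1+O(p^{-1})$ at $p=\infty$) and consider the reduction $$(\ln J-\alpha L_{out}^k)_-=0 .\tag{R}$$ Let $\mathbf f(\lambda,\mu)=(\lambda,e^{-\alpha\lambda^k}\mu)$. Say that $\mathbf F$ satisfies (D) on an open set $U'\subseteq U$ if $\mathbf f\circ\mathbf F\circ\mathbf f^{-1}\in\mathrm{SDiff}(2)$ there, i.e. it is a holomorphic local diffeomorphism on $\mathbf f(U')$ with Jacobian determinant $1$. **Proposition.** Let $(L_{in},M_{in},L_{out},M_{out})$ be a solution of the Riemann problem on $T$ with data $\mathbf F$ given on $U$. 1. If $\mathbf F$ satisfies (D) on $U$, then (R) holds for all $\mathbf t\in T$. 2. Suppose the solution is nondegenerate. Then $\mathbf F$ satisfies (D) on some open $U'\subseteq U$ containing all values $(L_{out},M_{out})(p,\mathbf t)$, $|p|=1$, $\mathbf t\in T$, if and only if $e^{-\alpha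 L_{in}^k}\{L_{in},M_{in}\}=e^{-\alpha L_{out}^k}\{L_{out},M_{out}\}$ for all $|p|=1$, $\mathbf t\in T$ (that is, $e^{-\alpha L^k}\{L,M\}$ is analytic in the whole $p$-plane). 3. Suppose the solution is nondegenerate, let $\mathbf t^0\in T$, and suppose that $p\mapsto(L_{out},M_{out})(p,\mathbf t^0)$ is injective on the circle $|p|=1$. Then (R) holds for all $\mathbf t$ in a neighbourhood of $\mathbf t^0$ if and only if $(L_{out},M_{out})$ has, near $\mathbf t^0$, dressing data satisfying the condition: there are an open $T'$ with $\mathbf t^0\in T'\subseteq T$, data $\mathbf F'$, injective on its domain $U'$ and satisfying (D) on $U'$, and $L'_{in},M'_{in}$ such that $(L'_{in},M'_{in},L_{out},M_{out})$ is a nondegenerate solution on $T'$ of the Riemann problem with data $\mathbf F'$. -/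

import Mathlib

open Filter Topology

noncomputable section

/-- A complex Banach space `E` of time sequences `t = (t₀, t₁, t₂, …)`: the coordinates `t ↦ tₙ` are
continuous and determine `t`, the unit vector `e₀ = (1, 0, 0, …)` of the variable `x = t₀` belongs
to `E`, and `∑ tₙ zⁿ` converges for every `t ∈ E` and every `z`. This covers finitely many times
`t₀, …, t_N` and also infinitely many, e.g. the sequences with `∑ n! |tₙ| < ∞`. -/
structure TimeSpace (E : Type*) [NormedAddCommGroup E] [NormedSpace ℂ E] where
  coord : ℕ → E →L[ℂ] ℂ
  coord_ext : ∀ s t : E, (∀ n, coord n s = coord n t) → s = t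
  e₀ : E
  coord_e₀ : ∀ n, coord n e₀ = if n = 0 then 1 else 0
  summable_coord : ∀ (t : E) (z : ℂ), Summable fun n => coord n t * z ^ n

section

variable {E : Type*} [NormedAddCommGroup E] [NormedSpace ℂ E]

/-- The bracket `{L, M} = L_p M_x - L_x M_p`, with `x = t₀`, of functions of `(p, t)`. -/
def bracket (τ : TimeSpace E) (L M : ℂ × E → ℂ) (z : ℂ × E) : ℂ :=
  fderiv ℂ L z (1, 0) * fderiv ℂ M z (0, τ.e₀) - fderiv ℂ L z (0, τ.e₀) * fderiv ℂ M z (1, 0)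

/-- `g` has the Laurent expansion `∑ cₙ pⁿ` (`n ∈ ℤ`) near `p = ∞`. -/
def HasLaurentAtInfty (g : ℂ → ℂ) (c : ℤ → ℂ) : Prop :=
  ∃ R : ℝ, ∀ p : ℂ, R < ‖p‖ → HasSum (fun n : ℤ => c n * p ^ n) (g p)

/-- `(g)₋ = 0`: the Laurent expansion of `g` at `p = ∞` has no negative powers of `p`. -/
def MinusPartVanishes (g : ℂ → ℂ) : Prop :=
  ∃ c : ℤ → ℂ, HasLaurentAtInfty g c ∧ ∀ n < 0, c n = 0

/-- The reduction condition `(ln J - α Lᵏ)₋ = 0`, `J = {L, M}`, at the time `t`. For the series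
considered here `J = 1 + O(1/p)` at `p = ∞`, so that `ln J` is the principal logarithm there. -/
def SatisfiesReduction (τ : TimeSpace E) (α : ℂ) (k : ℕ) (L M : ℂ × E → ℂ) (t : E) : Prop :=
  MinusPartVanishes fun p => Complex.log (bracket τ L M (p, t)) - α * L (p, t) ^ k

/-- The expansions `L = p + ∑_{n ≥ 1} uₙ(t) p⁻ⁿ` and
`M = ∑_{n ≥ 0} tₙ Lⁿ + ∑_{n ≥ 1} ṽₙ(t) p⁻ⁿ` in `|p| ≥ 1`, for the times `t ∈ T`. -/
def HasExpansions (τ : TimeSpace E) (T : Set E) (L M : ℂ × E → ℂ) : Prop :=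
  ∃ u v : ℕ → E → ℂ, ∀ t ∈ T, ∀ p : ℂ, 1 ≤ ‖p‖ →
    HasSum (fun n : ℕ => u n t * (p ^ (n + 1))⁻¹) (L (p, t) - p) ∧
    HasSum (fun n : ℕ => v n t * (p ^ (n + 1))⁻¹)
      (M (p, t) - ∑' n, τ.coord n t * L (p, t) ^ n)

/-- `F` is a local biholomorphism on the open set `U` of the plane. -/
structure IsLocalDiffOn (F : ℂ × ℂ → ℂ × ℂ) (U : Set (ℂ × ℂ)) : Prop where
  isOpen : IsOpen U
  analytic : AnalyticOnNhd ℂ F U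
  det_ne_zero : ∀ z ∈ U, (fderiv ℂ F z).det ≠ 0

/-- `G` is a local area-preserving biholomorphism on the open set `W` of the plane. -/
structure IsSDiffOn (G : ℂ × ℂ → ℂ × ℂ) (W : Set (ℂ × ℂ)) : Prop where
  isOpen : IsOpen W
  analytic : AnalyticOnNhd ℂ G W
  det_eq_one : ∀ w ∈ W, (fderiv ℂ G w).det = 1

/-- The map `f(λ, μ) = (λ, e^{-α λᵏ} μ)`, a bijection of the plane. -/
def redMap (α : ℂ) (k : ℕ) : ℂ × ℂ ≃ ℂ × ℂ where
  toFun z := (z.1, Complex.exp (-(α * z.1 ^ k)) * z.2)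
  invFun w := (w.1, Complex.exp (α * w.1 ^ k) * w.2)
  left_inv z := by
    ext
    · rfl
    · simp [← mul_assoc, ← Complex.exp_add]
  right_inv w := by
    ext
    · rfl
    · simp [← mul_assoc, ← Complex.exp_add]

/-- The condition `f ∘ F ∘ f⁻¹ ∈ SDiff(2)` for the dressing data `F`, given on `U`. -/
def DressingCondition (α : ℂ) (k : ℕ) (F : ℂ × ℂ → ℂ × ℂ) (U : Set (ℂ × ℂ)) : Prop :=
  IsSDiffOn (redMap α k ∘ F ∘ (redMap α k).symm) (redMap α k '' U)

/-- The functions `Lin, Min` (analytic in `|p| ≤ 1`) and `L, M` (the functions `L_out, M_out`,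
analytic in `1 ≤ |p| < ∞`, with the expansions at infinity), depending analytically on the times
`t ∈ T`, solve the Riemann problem `(Lin, Min) = F(L, M)` on the unit circle with the dressing
data `F`, a local diffeomorphism of the plane given on `U`. -/
structure IsRiemannSolution (τ : TimeSpace E) (T : Set E) (U : Set (ℂ × ℂ))
    (F : ℂ × ℂ → ℂ × ℂ) (Lin Min L M : ℂ × E → ℂ) : Prop where
  isOpen_times : IsOpen T
  isLocalDiff : IsLocalDiffOn F U
  analytic_Lin : AnalyticOnNhd ℂ Lin ({p : ℂ | ‖p‖ ≤ 1} ×ˢ T)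
  analytic_Min : AnalyticOnNhd ℂ Min ({p : ℂ | ‖p‖ ≤ 1} ×ˢ T)
  analytic_L : AnalyticOnNhd ℂ L ({p : ℂ | 1 ≤ ‖p‖} ×ˢ T)
  analytic_M : AnalyticOnNhd ℂ M ({p : ℂ | 1 ≤ ‖p‖} ×ˢ T)
  expansions : HasExpansions τ T L M
  mem_domain : ∀ p : ℂ, ‖p‖ = 1 → ∀ t ∈ T, (L (p, t), M (p, t)) ∈ U
  jump : ∀ p : ℂ, ‖p‖ = 1 → ∀ t ∈ T,
    (Lin (p, t), Min (p, t)) = F (L (p, t), M (p, t))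

/-- `{Lin, Min}` has no zeros in `|p| ≤ 1`, so that `dL ∧ dM / {L, M}` is analytic there. -/
def NondegenerateInside (τ : TimeSpace E) (T : Set E) (Lin Min : ℂ × E → ℂ) : Prop :=
  ∀ p : ℂ, ‖p‖ ≤ 1 → ∀ t ∈ T, bracket τ Lin Min (p, t) ≠ 0

/-- On the unit circle `e^{-α Lᵏ} {L, M}` takes the same values from the inside and from the
outside, i.e. it is one function, analytic in the whole plane. -/
def MatchesOnCircle (τ : TimeSpace E) (α : ℂ) (k : ℕ) (T : Set E)
    (Lin Min L M : ℂ × E → ℂ) : Prop :=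
  ∀ p : ℂ, ‖p‖ = 1 → ∀ t ∈ T,
    Complex.exp (-(α * Lin (p, t) ^ k)) * bracket τ Lin Min (p, t) =
      Complex.exp (-(α * L (p, t) ^ k)) * bracket τ L M (p, t)

end

end

/-!
The map `f` turns `ω = e^{-α λᵏ} dλ ∧ dμ` into the standard area form, so the dressing condition
says that `F` preserves `ω` (`dressingCondition_iff`). The bracket is the Jacobian of `(L, M)` on
the slices `t = t₀ + x e₀`, hence by the chain rule and the jump `F` preserves `ω` at the values
taken on the circle if `e^{-α Lᵏ} {L, M}` has there the same values from both sides and does not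
vanish, and conversely. The relation extends to a neighbourhood of these values, since the slice
map is a local diffeomorphism where the bracket does not vanish
(`IsRiemannSolution.exists_dressingCondition_iff_matches`).

At infinity `{L, M} = 1 + O(1/p)` (`IsRiemannSolution.exists_bracket_bound`), so that `ln {L, M} -
α Lᵏ` is a polynomial `P` up to terms which vanish at infinity, and the reduction says that it is
equal to `P`. If `e^{-α Lᵏ} {L, M}` extends to an entire function, then its quotient by `e^P` is
entire and tends to `1`, so it is `1` by Liouville's theorem
(`IsRiemannSolution.satisfiesReduction_of_matches`).

Conversely, in a reduced solution `e^{-α Lᵏ} {L, M} = e^P` is entire in `p` and analytic in `x`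
(`IsRiemannSolution.exists_exp_eq_form`), although the given `F` need not preserve `ω`. On the
slice through `t₀` the map `Φ (p, x) = (p, e^{α pᵏ} ∫₀ˣ e^P)` pulls `ω` back to `e^P dp ∧ dx`, as
does `w = (L, M)`, so `F' = Φ ∘ w⁻¹`, defined near the curve `(L, M)(|p| = 1, t₀)`, preserves `ω`
(`exists_dressing_data`). The corresponding inner functions have to be defined for all `t` near
`t₀` and not only on the slice. The level sets of the nondegenerate `(Lin, Min)` are transversal
to the slice, and projecting along them to the slice (`exists_leaf_projection`) before applying
`Φ` gives the inner functions. They satisfy the jump condition because `(L, M)` has near the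
circle the same level sets (`IsRiemannSolution.eventually_out_leaf`).
-/

/-! ### Jacobians -/

/-- The determinant `u₁ v₂ - v₁ u₂` of two vectors of the plane. -/
def cross (u v : ℂ × ℂ) : ℂ := u.1 * v.2 - v.1 * u.2

lemma det_eq_cross (A : ℂ × ℂ →L[ℂ] ℂ × ℂ) : A.det = cross (A (1, 0)) (A (0, 1)) := by
  have h := LinearMap.det_toMatrix (Module.Basis.finTwoProd ℂ) (A : ℂ × ℂ →ₗ[ℂ] ℂ × ℂ)
  rw [ContinuousLinearMap.det, ← h, Matrix.det_fin_two]
  simp [LinearMap.toMatrix_apply, cross]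

lemma cross_map (A : ℂ × ℂ →L[ℂ] ℂ × ℂ) (u v : ℂ × ℂ) :
    cross (A u) (A v) = A.det * cross u v := by
  have key : ∀ u : ℂ × ℂ, A u = u.1 • A (1, 0) + u.2 • A (0, 1) := fun u => by
    rw [← map_smul, ← map_smul, ← map_add]; simp
  rw [det_eq_cross, key u, key v]
  simp only [cross, Prod.fst_add, Prod.snd_add, Prod.smul_fst, Prod.smul_snd, smul_eq_mul]
  ring

/-- A linear map of the plane with nonzero determinant, as an invertible operator. -/
lemma exists_equiv_of_det_ne_zero {A : ℂ × ℂ →L[ℂ] ℂ × ℂ} (h : A.det ≠ 0) :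
    ∃ e : (ℂ × ℂ) ≃L[ℂ] ℂ × ℂ, (e : ℂ × ℂ →L[ℂ] ℂ × ℂ) = A :=
  ⟨A.toContinuousLinearEquivOfDetNeZero h, by ext <;> simp⟩

lemma det_fderiv_comp {H V : ℂ × ℂ → ℂ × ℂ} {z : ℂ × ℂ} (hH : DifferentiableAt ℂ H (V z))
    (hV : DifferentiableAt ℂ V z) :
    (fderiv ℂ (H ∘ V) z).det = (fderiv ℂ H (V z)).det * (fderiv ℂ V z).det := by
  rw [fderiv_comp _ hH hV, det_eq_cross, det_eq_cross (fderiv ℂ V z), ← cross_map]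
  rfl

section

variable {E : Type*} [NormedAddCommGroup E] [NormedSpace ℂ E]

lemma bracket_eq_cross (τ : TimeSpace E) {V : ℂ × E → ℂ × ℂ} {z : ℂ × E}
    (hV : DifferentiableAt ℂ V z) :
    bracket τ (fun y => (V y).1) (fun y => (V y).2) z =
      cross (fderiv ℂ V z (1, 0)) (fderiv ℂ V z (0, τ.e₀)) := by
  rw [bracket, fderiv.fst hV, fderiv.snd hV]
  simp [cross]

lemma bracket_comp (τ : TimeSpace E) {H : ℂ × ℂ → ℂ × ℂ} {V : ℂ × E → ℂ × ℂ} {z : ℂ × E}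
    (hH : DifferentiableAt ℂ H (V z)) (hV : DifferentiableAt ℂ V z) :
    bracket τ (fun y => (H (V y)).1) (fun y => (H (V y)).2) z =
      (fderiv ℂ H (V z)).det * bracket τ (fun y => (V y).1) (fun y => (V y).2) z := by
  rw [bracket_eq_cross τ hV, ← cross_map, bracket_eq_cross τ (V := fun y => H (V y)) (hH.comp z hV)]
  rw [show (fun y => H (V y)) = H ∘ V from rfl, fderiv_comp _ hH hV]
  rfl

lemma bracket_congr (τ : TimeSpace E) {L M L' M' : ℂ × E → ℂ} {z : ℂ × E} (hL : L =ᶠ[𝓝 z] L')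
    (hM : M =ᶠ[𝓝 z] M') : bracket τ L M z = bracket τ L' M' z := by
  rw [bracket, bracket, hL.fderiv_eq, hM.fderiv_eq]

lemma analyticAt_bracket (τ : TimeSpace E) {L M : ℂ × E → ℂ} {z : ℂ × E}
    (hL : AnalyticAt ℂ L z) (hM : AnalyticAt ℂ M z) :
    AnalyticAt ℂ (bracket τ L M) z := by
  have key : ∀ {f : ℂ × E → ℂ} (v : ℂ × E), AnalyticAt ℂ f z →
      AnalyticAt ℂ (fun y => fderiv ℂ f y v) z := fun v hf =>
    ((ContinuousLinearMap.apply ℂ ℂ v).analyticAt _).comp hf.fderiv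
  exact ((key _ hL).mul (key _ hM)).sub ((key _ hL).mul (key _ hM))

/-- The embedding of the `(p, x)`-plane as the slice `t = t₀ + x e₀`. -/
def slice (τ : TimeSpace E) (t₀ : E) (z : ℂ × ℂ) : ℂ × E := (z.1, t₀ + z.2 • τ.e₀)

lemma analyticAt_slice (τ : TimeSpace E) (t₀ : E) (z : ℂ × ℂ) :
    AnalyticAt ℂ (slice τ t₀) z :=
  (analyticAt_fst.prod (analyticAt_const.add (analyticAt_snd.smul analyticAt_const)))

lemma continuous_slice (τ : TimeSpace E) (t₀ : E) : Continuous (slice τ t₀) := by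
  unfold slice; fun_prop

lemma hasFDerivAt_slice (τ : TimeSpace E) (t₀ : E) (z : ℂ × ℂ) :
    HasFDerivAt (slice τ t₀) ((ContinuousLinearMap.fst ℂ ℂ ℂ).prod
      ((ContinuousLinearMap.snd ℂ ℂ ℂ).smulRight τ.e₀)) z :=
  hasFDerivAt_fst.prodMk ((hasFDerivAt_snd.smul_const τ.e₀).const_add t₀)

/-- On the slice `t = t₀ + x e₀` the bracket is the Jacobian determinant. -/
lemma det_fderiv_slice (τ : TimeSpace E) (t₀ : E) {V : ℂ × E → ℂ × ℂ} {z : ℂ × ℂ}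
    (hV : DifferentiableAt ℂ V (slice τ t₀ z)) :
    (fderiv ℂ (V ∘ slice τ t₀) z).det =
      bracket τ (fun y => (V y).1) (fun y => (V y).2) (slice τ t₀ z) := by
  rw [bracket_eq_cross τ hV, det_eq_cross,
    fderiv_comp _ hV (hasFDerivAt_slice τ t₀ z).differentiableAt, (hasFDerivAt_slice τ t₀ z).fderiv]
  simp

end

/-! ### The identity theorem near the unit circle -/

/-- Every point of the unit circle is an accumulation point of it. -/
lemma frequently_norm_eq_one {p₀ : ℂ} (hp₀ : ‖p₀‖ = 1) : ∃ᶠ p in 𝓝[≠] p₀, ‖p‖ = 1 := by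
  have hc : Tendsto (fun θ : ℝ => p₀ * Complex.exp (θ * Complex.I)) (𝓝[≠] 0) (𝓝[≠] p₀) := by
    refine tendsto_nhdsWithin_iff.2 ⟨?_, ?_⟩
    · have : Continuous fun θ : ℝ => p₀ * Complex.exp (θ * Complex.I) := by fun_prop
      simpa using (this.tendsto 0).mono_left nhdsWithin_le_nhds
    · have h1 : ∀ᶠ θ : ℝ in 𝓝[≠] 0, θ ∈ Set.Ioo (-1 : ℝ) 1 :=
        nhdsWithin_le_nhds (Ioo_mem_nhds (by norm_num) (by norm_num))
      filter_upwards [h1, self_mem_nhdsWithin] with θ hθ hθ0 h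
      have hp : p₀ ≠ 0 := by rintro rfl; simp at hp₀
      have h2 : Complex.exp (θ * Complex.I) = 1 := mul_left_cancel₀ hp (h.trans (mul_one _).symm)
      have h3 : Real.cos θ = 1 := by
        have := congrArg Complex.re h2
        rwa [Complex.exp_ofReal_mul_I_re] at this
      have := (Real.cos_eq_one_iff_of_lt_of_lt (by linarith [hθ.1, Real.pi_gt_three])
        (by linarith [hθ.2, Real.pi_gt_three])).1 h3
      exact hθ0 this
  refine hc.frequently (Eventually.frequently (Eventually.of_forall fun θ => ?_))
  simp [hp₀, Complex.norm_exp_ofReal_mul_I]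

lemma eventuallyEq_of_eq_on_circle {f g : ℂ → ℂ} {p₀ : ℂ} (hp₀ : ‖p₀‖ = 1)
    (hf : AnalyticAt ℂ f p₀) (hg : AnalyticAt ℂ g p₀) (h : ∀ p, ‖p‖ = 1 → f p = g p) :
    f =ᶠ[𝓝 p₀] g :=
  (hf.frequently_eq_iff_eventually_eq hg).1 ((frequently_norm_eq_one hp₀).mono h)

/-- An analytic function of `p` and of parameters which vanishes for `p` on the unit circle vanishes
near the circle. -/
lemma eventually_eq_zero_of_circle {X F : Type*} [NormedAddCommGroup X] [NormedSpace ℂ X]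
    [NormedAddCommGroup F] [NormedSpace ℂ F] [CompleteSpace F]
    {f : ℂ × X → F} {p₀ : ℂ} {x₀ : X} (hp₀ : ‖p₀‖ = 1) (hf : AnalyticAt ℂ f (p₀, x₀))
    (h : ∀ᶠ x in 𝓝 x₀, ∀ p, ‖p‖ = 1 → f (p, x) = 0) : ∀ᶠ z in 𝓝 (p₀, x₀), f z = 0 := by
  obtain ⟨ε, hε, hball⟩ := hf.exists_ball_analyticOnNhd
  rw [nhds_prod_eq]
  have h1 : ∀ᶠ p in 𝓝 p₀, p ∈ Metric.ball p₀ ε := Metric.ball_mem_nhds _ hε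
  have h2 : ∀ᶠ x in 𝓝 x₀, x ∈ Metric.ball x₀ ε := Metric.ball_mem_nhds _ hε
  refine (h1.prod_mk (h2.and h)).mono ?_
  rintro ⟨p, x⟩ ⟨hp, hx, hv⟩
  have han : AnalyticOnNhd ℂ (fun q => f (q, x)) (Metric.ball p₀ ε) := fun q hq =>
    AnalyticAt.fun_comp (g := f) (f := fun q => (q, x))
      (hball _ (by rw [← ball_prod_same]; exact ⟨hq, hx⟩)) (by fun_prop)
  have := han.eqOn_zero_of_preconnected_of_frequently_eq_zero
    (convex_ball p₀ ε).isPreconnected (Metric.mem_ball_self hε)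
    ((frequently_norm_eq_one hp₀).mono hv)
  exact this hp

/-! ### Inverse functions near a compact set -/

section

variable {X Y : Type*} [NormedAddCommGroup X] [NormedSpace ℂ X] [CompleteSpace X]
  [NormedAddCommGroup Y] [NormedSpace ℂ Y]

lemma injOn_nhds_of_fderiv_equiv {f : X → Y} {x : X} (hf : AnalyticAt ℂ f x)
    (hd : ∃ e : X ≃L[ℂ] Y, (e : X →L[ℂ] Y) = fderiv ℂ f x) : ∃ u ∈ 𝓝 x, Set.InjOn f u := by
  obtain ⟨e, he⟩ := hd
  have hs : HasStrictFDerivAt f (e : X →L[ℂ] Y) x := he ▸ hf.hasStrictFDerivAt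
  refine ⟨_, (hs.toOpenPartialHomeomorph f).open_source.mem_nhds
    (HasStrictFDerivAt.mem_toOpenPartialHomeomorph_source hs), ?_⟩
  exact (hs.toOpenPartialHomeomorph f).injOn

lemma exists_analytic_localInverse {f : X → Y} {x : X} (hf : AnalyticAt ℂ f x)
    (hd : ∃ e : X ≃L[ℂ] Y, (e : X →L[ℂ] Y) = fderiv ℂ f x) :
    ∃ g : Y → X, AnalyticAt ℂ g (f x) ∧ (∀ᶠ y in 𝓝 (f x), f (g y) = y) ∧ g (f x) = x := by
  obtain ⟨e, he⟩ := hd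
  have hs : HasStrictFDerivAt f (e : X →L[ℂ] Y) x := he ▸ hf.hasStrictFDerivAt
  have hx := HasStrictFDerivAt.mem_toOpenPartialHomeomorph_source hs
  refine ⟨(hs.toOpenPartialHomeomorph f).symm, ?_, ?_, ?_⟩
  · exact (hs.toOpenPartialHomeomorph f).analyticAt_symm' hx hf he.symm
  · exact (hs.toOpenPartialHomeomorph f).eventually_right_inverse'  hx
  · exact (hs.toOpenPartialHomeomorph f).left_inv hx

lemma eventually_fderiv_equiv {f : X → Y} {x : X} [CompleteSpace Y] (hf : AnalyticAt ℂ f x)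
    (hd : ∃ e : X ≃L[ℂ] Y, (e : X →L[ℂ] Y) = fderiv ℂ f x) :
    ∀ᶠ y in 𝓝 x, ∃ e : X ≃L[ℂ] Y, (e : X →L[ℂ] Y) = fderiv ℂ f y := by
  obtain ⟨e, he⟩ := hd
  exact hf.fderiv.continuousAt.eventually (he ▸ ContinuousLinearEquiv.nhds e)

/-- The inverse function theorem near a compact set: a map which is injective on a compact set and
has there invertible derivatives is biholomorphic on a neighbourhood, which can be chosen inside any
given one. -/
theorem exists_inverse_near_compact [CompleteSpace Y] {f : X → Y} {K O : Set X}
    (hK : IsCompact K) (hO : ∀ x ∈ K, O ∈ 𝓝 x) (hf : AnalyticOnNhd ℂ f K)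
    (hd : ∀ x ∈ K, ∃ e : X ≃L[ℂ] Y, (e : X →L[ℂ] Y) = fderiv ℂ f x) (hinj : Set.InjOn f K) :
    ∃ (N : Set X) (g : Y → X), IsOpen N ∧ K ⊆ N ∧ N ⊆ O ∧ Set.InjOn f N ∧ IsOpen (f '' N) ∧
      AnalyticOnNhd ℂ g (f '' N) ∧ ∀ x ∈ N, g (f x) = x := by
  obtain ⟨t, ht, htinj⟩ := hinj.exists_mem_nhdsSet hK (fun x hx => (hf x hx).continuousAt)
    fun x hx => injOn_nhds_of_fderiv_equiv (hf x hx) (hd x hx)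
  have hev : ∀ᶠ x in 𝓝ˢ K, x ∈ O ∧ AnalyticAt ℂ f x ∧
      ∃ e : X ≃L[ℂ] Y, (e : X →L[ℂ] Y) = fderiv ℂ f x :=
    eventually_nhdsSet_iff_forall.2 fun x hx => Filter.Eventually.and (hO x hx)
      ((hf x hx).eventually_analyticAt.and (eventually_fderiv_equiv (hf x hx) (hd x hx)))
  obtain ⟨N, hN, hKN, hNs⟩ := mem_nhdsSet_iff_exists.1 (inter_mem hev ht)
  have hNinj : Set.InjOn f N := htinj.mono fun x hx => (hNs hx).2
  have hNf : ∀ x ∈ N, AnalyticAt ℂ f x := fun x hx => (hNs hx).1.2.1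
  -- near each value, the global inverse is the analytic local one
  have loc : ∀ x ∈ N, ∃ h : Y → X, AnalyticAt ℂ h (f x) ∧
      ∀ᶠ y in 𝓝 (f x), f (h y) = y ∧ h y ∈ N := fun x hx => by
    obtain ⟨h, ha, hr, hx'⟩ := exists_analytic_localInverse (hNf x hx) (hNs hx).1.2.2
    refine ⟨h, ha, hr.and (ha.continuousAt.eventually_mem ?_)⟩
    rw [hx']
    exact hN.mem_nhds hx
  have hleft : ∀ x ∈ N, Function.invFunOn f N (f x) = x := fun x hx =>
    hNinj.leftInvOn_invFunOn hx
  refine ⟨N, Function.invFunOn f N, hN, hKN, fun x hx => (hNs hx).1.1, hNinj, ?_, ?_, hleft⟩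
  · rw [isOpen_iff_mem_nhds]
    rintro _ ⟨x, hx, rfl⟩
    obtain ⟨h, -, hh⟩ := loc x hx
    exact hh.mono fun y hy => ⟨h y, hy.2, hy.1⟩
  · rintro _ ⟨x, hx, rfl⟩
    obtain ⟨h, ha, hh⟩ := loc x hx
    refine ha.congr (hh.mono fun y hy => ?_)
    rw [← hleft _ hy.2, hy.1]

end

/-! ### The dressing condition as an equation for the Jacobian -/

lemma det_fderiv_shear {g : ℂ × ℂ → ℂ} {z : ℂ × ℂ} (hg : DifferentiableAt ℂ g z) :
    (fderiv ℂ (fun y : ℂ × ℂ => (y.1, g y)) z).det = fderiv ℂ g z (0, 1) := by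
  rw [(hasFDerivAt_fst.prodMk hg.hasFDerivAt).fderiv, det_eq_cross]
  simp [cross]

lemma fderiv_apply_zero_one {g : ℂ × ℂ → ℂ} {z : ℂ × ℂ} (hg : DifferentiableAt ℂ g z) :
    fderiv ℂ g z (0, 1) = deriv (fun s => g (z.1, s)) z.2 := by
  have h1 : HasDerivAt (fun s : ℂ => (z.1, s)) ((0 : ℂ), (1 : ℂ)) z.2 :=
    (hasDerivAt_const _ _).prodMk (hasDerivAt_id _)
  exact ((hg.hasFDerivAt (x := z)).comp_hasDerivAt (f := fun s => (z.1, s)) z.2 h1).deriv.symm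

lemma analyticAt_exp_mul_pow (c : ℂ) (k : ℕ) {X : Type*} [NormedAddCommGroup X] [NormedSpace ℂ X]
    {f : X → ℂ} {z : X} (hf : AnalyticAt ℂ f z) :
    AnalyticAt ℂ (fun y => Complex.exp (c * f y ^ k)) z :=
  (analyticAt_const.mul (hf.pow k)).cexp

lemma analyticAt_exp_neg_mul_pow (c : ℂ) (k : ℕ) {X : Type*} [NormedAddCommGroup X]
    [NormedSpace ℂ X] {f : X → ℂ} {z : X} (hf : AnalyticAt ℂ f z) :
    AnalyticAt ℂ (fun y => Complex.exp (-(c * f y ^ k))) z :=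
  (analyticAt_const.mul (hf.pow k)).neg.cexp

lemma analyticAt_redMap (α : ℂ) (k : ℕ) (z : ℂ × ℂ) : AnalyticAt ℂ (redMap α k) z :=
  analyticAt_fst.prod ((analyticAt_exp_neg_mul_pow α k analyticAt_fst).mul analyticAt_snd)

lemma analyticAt_redMap_symm (α : ℂ) (k : ℕ) (z : ℂ × ℂ) : AnalyticAt ℂ (redMap α k).symm z :=
  analyticAt_fst.prod ((analyticAt_exp_mul_pow α k analyticAt_fst).mul analyticAt_snd)

lemma det_fderiv_redMap (α : ℂ) (k : ℕ) (z : ℂ × ℂ) :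
    (fderiv ℂ (redMap α k) z).det = Complex.exp (-(α * z.1 ^ k)) := by
  have hg : DifferentiableAt ℂ (fun y : ℂ × ℂ => Complex.exp (-(α * y.1 ^ k)) * y.2) z :=
    ((analyticAt_exp_neg_mul_pow α k analyticAt_fst).mul analyticAt_snd).differentiableAt
  refine (det_fderiv_shear hg).trans ((fderiv_apply_zero_one hg).trans ?_)
  simp

lemma isOpen_redMap_image (α : ℂ) (k : ℕ) {U : Set (ℂ × ℂ)} (hU : IsOpen U) :
    IsOpen (redMap α k '' U) := by
  have hc : Continuous (redMap α k).symm :=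
    continuous_iff_continuousAt.2 fun z => (analyticAt_redMap_symm α k z).continuousAt
  rw [Equiv.image_eq_preimage_symm]
  exact hU.preimage hc

/-- The area form `e^{-α λᵏ} dλ ∧ dμ` is preserved by `F` at the point `z`. -/
def PreservesForm (α : ℂ) (k : ℕ) (F : ℂ × ℂ → ℂ × ℂ) (z : ℂ × ℂ) : Prop :=
  Complex.exp (-(α * (F z).1 ^ k)) * (fderiv ℂ F z).det = Complex.exp (-(α * z.1 ^ k))

/-- The map `f` turns the form `e^{-α λᵏ} dλ ∧ dμ` into the standard area form. -/
lemma dressingCondition_iff {α : ℂ} {k : ℕ} {F : ℂ × ℂ → ℂ × ℂ} {U : Set (ℂ × ℂ)} (hU : IsOpen U)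
    (hF : AnalyticOnNhd ℂ F U) : DressingCondition α k F U ↔ ∀ z ∈ U, PreservesForm α k F z := by
  have hG : AnalyticOnNhd ℂ (redMap α k ∘ F ∘ (redMap α k).symm) (redMap α k '' U) := by
    rintro _ ⟨z, hz, rfl⟩
    refine (analyticAt_redMap α k _).comp (AnalyticAt.comp ?_ (analyticAt_redMap_symm α k _))
    simpa using hF z hz
  have hdet : ∀ z ∈ U,
      (fderiv ℂ (redMap α k ∘ F ∘ (redMap α k).symm) (redMap α k z)).det *
        Complex.exp (-(α * z.1 ^ k)) =
      Complex.exp (-(α * (F z).1 ^ k)) * (fderiv ℂ F z).det := fun z hz => by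
    rw [← det_fderiv_redMap, ← det_fderiv_redMap, ← det_fderiv_comp
      (hG _ ⟨z, hz, rfl⟩).differentiableAt (analyticAt_redMap α k z).differentiableAt,
      ← det_fderiv_comp (analyticAt_redMap α k _).differentiableAt (hF z hz).differentiableAt]
    have hc : (redMap α k ∘ F ∘ (redMap α k).symm) ∘ redMap α k = redMap α k ∘ F := by
      ext1 y
      simp
    rw [hc]
  constructor
  · intro h z hz
    have := hdet z hz
    rw [h.det_eq_one _ ⟨z, hz, rfl⟩, one_mul] at this
    exact this.symm
  · intro h
    refine ⟨isOpen_redMap_image α k hU, hG, ?_⟩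
    rintro _ ⟨z, hz, rfl⟩
    have := hdet z hz
    rw [h z hz] at this
    exact mul_right_cancel₀ (Complex.exp_ne_zero _) (this.trans (one_mul _).symm)

/-! ### The jump on the unit circle -/

section

variable {E : Type*} [NormedAddCommGroup E] [NormedSpace ℂ E] {τ : TimeSpace E} {α : ℂ} {k : ℕ}
  {T : Set E} {U : Set (ℂ × ℂ)} {F : ℂ × ℂ → ℂ × ℂ} {Lin Min L M : ℂ × E → ℂ}

namespace IsRiemannSolution

lemma analyticAt_in (h : IsRiemannSolution τ T U F Lin Min L M) {p : ℂ} (hp : ‖p‖ ≤ 1) {t : E}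
    (ht : t ∈ T) : AnalyticAt ℂ (fun z => (Lin z, Min z)) (p, t) :=
  (h.analytic_Lin (p, t) ⟨hp, ht⟩).prod (h.analytic_Min (p, t) ⟨hp, ht⟩)

lemma analyticAt_out (h : IsRiemannSolution τ T U F Lin Min L M) {p : ℂ} (hp : 1 ≤ ‖p‖) {t : E}
    (ht : t ∈ T) : AnalyticAt ℂ (fun z => (L z, M z)) (p, t) :=
  (h.analytic_L (p, t) ⟨hp, ht⟩).prod (h.analytic_M (p, t) ⟨hp, ht⟩)

lemma analyticAt_F (h : IsRiemannSolution τ T U F Lin Min L M) {p : ℂ} (hp : ‖p‖ = 1) {t : E}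
    (ht : t ∈ T) : AnalyticAt ℂ F (L (p, t), M (p, t)) :=
  h.isLocalDiff.analytic _ (h.mem_domain p hp t ht)

lemma eventually_jump (h : IsRiemannSolution τ T U F Lin Min L M) {p : ℂ} (hp : ‖p‖ = 1) {t : E}
    (ht : t ∈ T) : (fun z => (Lin z, Min z)) =ᶠ[𝓝 (p, t)] fun z => F (L z, M z) := by
  have hFW : AnalyticAt ℂ (fun z => F (L z, M z)) (p, t) :=
    AnalyticAt.fun_comp (g := F) (f := fun z => (L z, M z)) (h.analyticAt_F hp ht)
      (h.analyticAt_out hp.ge ht)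
  have := eventually_eq_zero_of_circle hp ((h.analyticAt_in hp.le ht).sub hFW)
    (by filter_upwards [h.isOpen_times.mem_nhds ht] with s hs q hq
        simpa [sub_eq_zero] using h.jump q hq s hs)
  exact this.mono fun z hz => sub_eq_zero.1 hz

lemma bracket_in (h : IsRiemannSolution τ T U F Lin Min L M) {p : ℂ} (hp : ‖p‖ = 1) {t : E}
    (ht : t ∈ T) : bracket τ Lin Min (p, t) =
      (fderiv ℂ F (L (p, t), M (p, t))).det * bracket τ L M (p, t) := by
  have hj := h.eventually_jump hp ht
  refine (bracket_congr τ (hj.fun_comp Prod.fst) (hj.fun_comp Prod.snd)).trans ?_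
  exact bracket_comp τ (h.analyticAt_F hp ht).differentiableAt
    (h.analyticAt_out hp.ge ht).differentiableAt

lemma matches_of_preservesForm (h : IsRiemannSolution τ T U F Lin Min L M)
    (hF : ∀ p : ℂ, ‖p‖ = 1 → ∀ t ∈ T, PreservesForm α k F (L (p, t), M (p, t))) :
    MatchesOnCircle τ α k T Lin Min L M := fun p hp t ht => by
  have h1 := hF p hp t ht
  rw [PreservesForm, ← h.jump p hp t ht] at h1
  rw [h.bracket_in hp ht, ← mul_assoc, h1]

lemma matches_of_dressingCondition (h : IsRiemannSolution τ T U F Lin Min L M)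
    {U' : Set (ℂ × ℂ)} (hU' : IsOpen U') (hsub : U' ⊆ U)
    (hmem : ∀ p : ℂ, ‖p‖ = 1 → ∀ t ∈ T, (L (p, t), M (p, t)) ∈ U')
    (hD : DressingCondition α k F U') : MatchesOnCircle τ α k T Lin Min L M := by
  rw [dressingCondition_iff hU' (h.isLocalDiff.analytic.mono hsub)] at hD
  exact h.matches_of_preservesForm fun p hp t ht => hD _ (hmem p hp t ht)

lemma preservesForm_of_matches (h : IsRiemannSolution τ T U F Lin Min L M)
    (hm : MatchesOnCircle τ α k T Lin Min L M) {p : ℂ} (hp : ‖p‖ = 1) {t : E} (ht : t ∈ T)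
    (hJ : bracket τ L M (p, t) ≠ 0) : PreservesForm α k F (L (p, t), M (p, t)) := by
  have h1 := hm p hp t ht
  rw [h.bracket_in hp ht, ← mul_assoc] at h1
  rw [PreservesForm, ← h.jump p hp t ht]
  exact mul_right_cancel₀ hJ h1

lemma bracket_out_ne_zero (h : IsRiemannSolution τ T U F Lin Min L M)
    (hn : NondegenerateInside τ T Lin Min) {p : ℂ} (hp : ‖p‖ = 1) {t : E} (ht : t ∈ T) :
    bracket τ L M (p, t) ≠ 0 := fun h0 => by
  apply hn p hp.le t ht
  rw [h.bracket_in hp ht, h0, mul_zero]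

lemma eventually_slice_mem (h : IsRiemannSolution τ T U F Lin Min L M) {t : E} (ht : t ∈ T) :
    ∀ᶠ s : ℂ in 𝓝 0, t + s • τ.e₀ ∈ T := by
  have hc : Continuous fun s : ℂ => t + s • τ.e₀ := by fun_prop
  exact hc.continuousAt.eventually_mem (h.isOpen_times.mem_nhds (by simpa using ht))

/-- The form is preserved near the values taken on the circle, since `(p, x) ↦ (L, M)` is a local
diffeomorphism there. -/
lemma eventually_preservesForm (h : IsRiemannSolution τ T U F Lin Min L M)
    (hn : NondegenerateInside τ T Lin Min) (hm : MatchesOnCircle τ α k T Lin Min L M)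
    {p : ℂ} (hp : ‖p‖ = 1) {t : E} (ht : t ∈ T) :
    ∀ᶠ z in 𝓝 (L (p, t), M (p, t)), PreservesForm α k F z := by
  set w : ℂ × ℂ → ℂ × ℂ := (fun z => (L z, M z)) ∘ slice τ t with hw
  have hs0 : slice τ t (p, 0) = (p, t) := by simp [slice]
  have hwp : w (p, 0) = (L (p, t), M (p, t)) := by simp [hw, hs0]
  have hwa : AnalyticAt ℂ w (p, 0) :=
    AnalyticAt.comp (by rw [hs0]; exact h.analyticAt_out hp.ge ht) (analyticAt_slice τ t _)
  have hdet : (fderiv ℂ w (p, 0)).det ≠ 0 := by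
    rw [hw, det_fderiv_slice τ t (by rw [hs0]; exact (h.analyticAt_out hp.ge ht).differentiableAt),
      hs0]
    exact h.bracket_out_ne_zero hn hp ht
  have hFa := h.analyticAt_F hp ht
  rw [← hwp] at hFa ⊢
  set D : ℂ × ℂ → ℂ := fun z => Complex.exp (-(α * (F z).1 ^ k)) * (fderiv ℂ F z).det -
    Complex.exp (-(α * z.1 ^ k)) with hD
  have hDa : AnalyticAt ℂ D (w (p, 0)) := by
    have happ : ∀ v, AnalyticAt ℂ (fun z => fderiv ℂ F z v) (w (p, 0)) := fun v =>
      ((ContinuousLinearMap.apply ℂ (ℂ × ℂ) v).analyticAt _).comp hFa.fderiv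
    have hdetF : AnalyticAt ℂ (fun z => (fderiv ℂ F z).det) (w (p, 0)) := by
      simp only [det_eq_cross, cross]
      exact ((analyticAt_fst.fun_comp (happ _)).mul (analyticAt_snd.fun_comp (happ _))).sub
        ((analyticAt_fst.fun_comp (happ _)).mul (analyticAt_snd.fun_comp (happ _)))
    exact ((analyticAt_exp_neg_mul_pow α k (analyticAt_fst.fun_comp hFa)).mul hdetF).sub
      (analyticAt_exp_neg_mul_pow α k analyticAt_fst)
  have hDw : ∀ᶠ y in 𝓝 (p, (0 : ℂ)), D (w y) = 0 := by
    refine eventually_eq_zero_of_circle hp (hDa.fun_comp hwa) ?_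
    filter_upwards [h.eventually_slice_mem ht] with s hs q hq
    exact sub_eq_zero.2 (h.preservesForm_of_matches hm hq hs (h.bracket_out_ne_zero hn hq hs))
  obtain ⟨g, hga, hgr, hgp⟩ := exists_analytic_localInverse hwa (exists_equiv_of_det_ne_zero hdet)
  have hgt : Tendsto g (𝓝 (w (p, 0))) (𝓝 (p, 0)) := by simpa [hgp] using hga.continuousAt.tendsto
  filter_upwards [hgt.eventually hDw, hgr] with z hz hzr
  rw [hzr] at hz
  exact sub_eq_zero.1 hz

/-- The dressing condition near the values taken on the circle is the analyticity of
`e^{-α Lᵏ} {L, M}` across the circle. -/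
theorem exists_dressingCondition_iff_matches (h : IsRiemannSolution τ T U F Lin Min L M)
    (hn : NondegenerateInside τ T Lin Min) :
    (∃ U' : Set (ℂ × ℂ), IsOpen U' ∧ U' ⊆ U ∧
        (∀ p : ℂ, ‖p‖ = 1 → ∀ t ∈ T, (L (p, t), M (p, t)) ∈ U') ∧ DressingCondition α k F U') ↔
      MatchesOnCircle τ α k T Lin Min L M := by
  constructor
  · rintro ⟨U', hU', hsub, hmem, hD⟩
    exact h.matches_of_dressingCondition hU' hsub hmem hD
  · intro hm
    refine ⟨U ∩ interior {z | PreservesForm α k F z}, h.isLocalDiff.isOpen.inter isOpen_interior,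
      Set.inter_subset_left, fun p hp t ht => ⟨h.mem_domain p hp t ht,
        mem_interior_iff_mem_nhds.2 (h.eventually_preservesForm hn hm hp ht)⟩, ?_⟩
    rw [dressingCondition_iff (h.isLocalDiff.isOpen.inter isOpen_interior)
      (h.isLocalDiff.analytic.mono Set.inter_subset_left)]
    exact fun z hz => (interior_subset hz.2 : z ∈ {z | PreservesForm α k F z})

end IsRiemannSolution

end

/-! ### Laurent expansions at infinity -/

/-- A power series which converges near infinity converges to an entire function. -/
lemma differentiable_tsum_pow {c : ℕ → ℂ}
    (h : ∀ᶠ z in Bornology.cobounded ℂ, Summable fun n => c n * z ^ n) :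
    Differentiable ℂ fun z => ∑' n, c n * z ^ n := by
  intro z
  obtain ⟨y, hy, hzy⟩ := (h.and (tendsto_norm_cobounded_atTop.eventually_gt_atTop ‖z‖)).exists
  have hd : DifferentiableOn ℂ (fun z => ∑' n, c n * z ^ n) (Metric.ball 0 ‖y‖) := by
    refine Complex.differentiableOn_tsum_of_summable_norm hy.norm (fun n => ?_)
      Metric.isOpen_ball fun n x hx => ?_
    · fun_prop
    · rw [mem_ball_zero_iff] at hx
      simp only [norm_mul, norm_pow]
      gcongr
  exact hd.differentiableAt (Metric.isOpen_ball.mem_nhds (by simpa using hzy))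

/-- If `g` is a polynomial `P` up to terms which vanish at infinity, then `(g)₋ = 0` means that
`g` is equal to `P`. -/
lemma minusPartVanishes_iff {g : ℂ → ℂ} {P : Polynomial ℂ}
    (hg : Tendsto (fun p => g p - P.eval p) (Bornology.cobounded ℂ) (𝓝 0)) :
    MinusPartVanishes g ↔ ∀ᶠ p in Bornology.cobounded ℂ, g p = P.eval p := by
  constructor
  · rintro ⟨c, ⟨R, hR⟩, hc⟩
    have hsum : ∀ᶠ p in Bornology.cobounded ℂ, HasSum (fun n : ℕ => c n * p ^ n) (g p) := by
      filter_upwards [tendsto_norm_cobounded_atTop.eventually_gt_atTop R] with p hp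
      have hz := hR p hp
      rw [← Nat.cast_injective.hasSum_iff] at hz
      · simpa [Function.comp_def] using hz
      · intro n hn
        rw [hc n, zero_mul]
        by_contra! h0
        exact hn ⟨n.toNat, by simp [h0]⟩
    have hd : Differentiable ℂ fun p => (∑' n : ℕ, c n * p ^ n) - P.eval p :=
      (differentiable_tsum_pow (hsum.mono fun p hp => hp.summable)).sub P.differentiable
    have hlim : Tendsto (fun p => (∑' n : ℕ, c n * p ^ n) - P.eval p) (cocompact ℂ) (𝓝 0) := by
      rw [← Metric.cobounded_eq_cocompact]
      exact hg.congr' (hsum.mono fun p hp => by simp only [hp.tsum_eq])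
    filter_upwards [hsum] with p hp
    rw [← sub_eq_zero, ← hp.tsum_eq]
    exact hd.apply_eq_of_tendsto_cocompact p hlim
  · intro h
    rw [(Metric.hasBasis_cobounded_compl_closedBall (0 : ℂ)).eventually_iff] at h
    obtain ⟨R, -, hR⟩ := h
    refine ⟨fun n => if 0 ≤ n then P.coeff n.toNat else 0, ⟨R, fun p hp => ?_⟩,
      fun n hn => if_neg (by omega)⟩
    rw [hR (by simpa using hp), ← Nat.cast_injective.hasSum_iff]
    · have : HasSum (fun n : ℕ => P.coeff n * p ^ n) (P.eval p) := by
        rw [Polynomial.eval_eq_sum_range]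
        refine hasSum_sum_of_ne_finset_zero fun n hn => ?_
        rw [Polynomial.coeff_eq_zero_of_natDegree_lt (by simpa using hn), zero_mul]
      simpa [Function.comp_def] using this
    · intro n hn
      simp only
      rw [if_neg, zero_mul]
      intro h0
      exact hn ⟨n.toNat, by simp [h0]⟩

/-- The polynomial part of a Laurent series `pᴺ ψ(1/p)` at infinity. -/
lemma exists_polynomial_part (N : ℕ) : ∀ {ψ : ℂ → ℂ}, AnalyticAt ℂ ψ 0 →
    ∃ P : Polynomial ℂ, P.natDegree ≤ N ∧
      Tendsto (fun p => p ^ N * ψ p⁻¹ - P.eval p) (Bornology.cobounded ℂ) (𝓝 0) := by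
  induction N with
  | zero =>
    intro ψ hψ
    refine ⟨Polynomial.C (ψ 0), by simp, ?_⟩
    have := (hψ.continuousAt.tendsto.comp tendsto_inv₀_cobounded).sub_const (ψ 0)
    simpa [Function.comp_def] using this
  | succ N ih =>
    intro ψ hψ
    have hd : AnalyticAt ℂ (dslope ψ 0) 0 := by
      obtain ⟨q, hq⟩ := hψ
      exact hq.has_fpower_series_dslope_fslope.analyticAt
    obtain ⟨P, hP, hlim⟩ := ih hd
    refine ⟨Polynomial.C (ψ 0) * Polynomial.X ^ (N + 1) + P, ?_, hlim.congr' ?_⟩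
    · refine (Polynomial.natDegree_add_le _ _).trans (max_le ?_ (by omega))
      exact Polynomial.natDegree_C_mul_X_pow_le _ _
    · filter_upwards [tendsto_norm_cobounded_atTop.eventually_gt_atTop 0] with p hp
      have hp0 : p ≠ 0 := norm_pos_iff.1 hp
      have h1 : ψ p⁻¹ = ψ 0 + p⁻¹ * dslope ψ 0 p⁻¹ := by
        have := sub_smul_dslope ψ 0 p⁻¹
        rw [sub_zero, smul_eq_mul] at this
        rw [this]; ring
      rw [h1]
      simp only [Polynomial.eval_add, Polynomial.eval_mul, Polynomial.eval_C, Polynomial.eval_pow,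
        Polynomial.eval_X]
      field_simp
      ring

/-- An expansion `A = ∑_{n ≥ 1} aₙ p⁻ⁿ` in `|p| ≥ 1` as an analytic function of `1/p`. -/
lemma exists_analytic_of_expansion {A : ℂ → ℂ} {a : ℕ → ℂ} (hA : AnalyticOnNhd ℂ A {p | 1 ≤ ‖p‖})
    (hs : ∀ p : ℂ, 1 ≤ ‖p‖ → HasSum (fun n : ℕ => a n * (p ^ (n + 1))⁻¹) (A p)) :
    ∃ ψ : ℂ → ℂ, AnalyticOnNhd ℂ ψ (Metric.closedBall 0 1) ∧
      ∀ p, 1 ≤ ‖p‖ → A p = p⁻¹ * ψ p⁻¹ := by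
  set ψ : ℂ → ℂ := fun q => if q = 0 then a 0 else q⁻¹ * A q⁻¹ with hψ
  refine ⟨ψ, fun q hq => ?_, fun p hp => ?_⟩
  · rw [mem_closedBall_zero_iff] at hq
    rcases eq_or_ne q 0 with rfl | hq0
    · suffices HasFPowerSeriesAt ψ (FormalMultilinearSeries.ofScalars ℂ a) 0 from this.analyticAt
      rw [hasFPowerSeriesAt_iff]
      simp only [FormalMultilinearSeries.coeff_ofScalars]
      filter_upwards [Metric.ball_mem_nhds (0 : ℂ) one_pos] with z hz
      rw [mem_ball_zero_iff] at hz
      rcases eq_or_ne z 0 with rfl | hz0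
      · have := hasSum_ite_eq (0 : ℕ) (a 0)
        simp only [hψ, add_zero, if_true]
        refine (congrArg (HasSum · _) (funext fun n => ?_)).mpr this
        rcases n with _ | n <;> simp
      · have h1 : 1 ≤ ‖z⁻¹‖ := by
          rw [norm_inv]; exact (one_le_inv₀ (norm_pos_iff.2 hz0)).2 hz.le
        have := (hs _ h1).mul_left z⁻¹
        simp only [hψ, zero_add, if_neg hz0]
        refine (congrArg (HasSum · _) (funext fun n => ?_)).mpr this
        simp only [smul_eq_mul, inv_pow, inv_inv]
        field_simp
        ring
    · have h1 : 1 ≤ ‖q⁻¹‖ := by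
        rw [norm_inv]; exact (one_le_inv₀ (norm_pos_iff.2 hq0)).2 hq
      have : AnalyticAt ℂ (fun q => q⁻¹ * A q⁻¹) q :=
        (analyticAt_inv hq0).mul (AnalyticAt.fun_comp (g := A) (hA _ h1) (analyticAt_inv hq0))
      refine this.congr ?_
      filter_upwards [isOpen_ne.mem_nhds hq0] with z hz
      simp only [hψ, if_neg hz]
  · have hp0 : p ≠ 0 := norm_pos_iff.1 (one_pos.trans_le hp)
    simp [hψ, hp0]

/-- Schwarz's lemma for an expansion in negative powers. -/
lemma norm_le_div_of_expansion {A : ℂ → ℂ} {a : ℕ → ℂ} (hA : AnalyticOnNhd ℂ A {p | 1 ≤ ‖p‖})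
    (hs : ∀ p : ℂ, 1 ≤ ‖p‖ → HasSum (fun n : ℕ => a n * (p ^ (n + 1))⁻¹) (A p)) {C : ℝ}
    (hC : ∀ p, ‖p‖ = 1 → ‖A p‖ ≤ C) {p : ℂ} (hp : 1 ≤ ‖p‖) : ‖A p‖ ≤ C / ‖p‖ := by
  obtain ⟨ψ, hψ, hAψ⟩ := exists_analytic_of_expansion hA hs
  have hb : ‖ψ p⁻¹‖ ≤ C := by
    refine Complex.norm_le_of_forall_mem_frontier_norm_le (U := Metric.ball 0 1)
      Metric.isBounded_ball ?_ (fun q hq => ?_) ?_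
    · refine DifferentiableOn.diffContOnCl ?_
      rw [closure_ball _ one_ne_zero]
      exact hψ.differentiableOn
    · rw [frontier_ball _ one_ne_zero, mem_sphere_zero_iff_norm] at hq
      have hq1 : ‖q⁻¹‖ = 1 := by rw [norm_inv, hq, inv_one]
      have := hC q⁻¹ hq1
      rwa [hAψ _ hq1.ge, inv_inv, norm_mul, hq, one_mul] at this
    · rw [closure_ball _ one_ne_zero, mem_closedBall_zero_iff, norm_inv]
      exact inv_le_one_of_one_le₀ hp
  rw [hAψ p hp, norm_mul, norm_inv, div_eq_inv_mul]
  gcongr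

/-- The derivatives of an expansion in negative powers, depending on a parameter, are `O(1/p)`
locally uniformly in the parameter. -/
lemma norm_fderiv_le_of_expansion {A : ℂ × ℂ → ℂ} {a : ℕ → ℂ → ℂ} {ρ : ℝ} (hρ : 0 < ρ)
    (hA : AnalyticOnNhd ℂ A ({p | 1 ≤ ‖p‖} ×ˢ Metric.ball 0 ρ))
    (hs : ∀ p s : ℂ, 1 ≤ ‖p‖ → ‖s‖ < ρ →
      HasSum (fun n : ℕ => a n s * (p ^ (n + 1))⁻¹) (A (p, s))) :
    ∃ C : ℝ, 0 ≤ C ∧ ∀ p s : ℂ, 2 ≤ ‖p‖ → ‖s‖ < ρ / 4 →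
      ‖fderiv ℂ A (p, s) (1, 0)‖ ≤ C / ‖p‖ ∧ ‖fderiv ℂ A (p, s) (0, 1)‖ ≤ C / ‖p‖ := by
  have hcpt : IsCompact (Metric.sphere (0 : ℂ) 1 ×ˢ Metric.closedBall (0 : ℂ) (ρ / 2)) :=
    (isCompact_sphere _ _).prod (isCompact_closedBall _ _)
  have hmem : ∀ p s : ℂ, 1 ≤ ‖p‖ → ‖s‖ < ρ → (p, s) ∈ {p : ℂ | 1 ≤ ‖p‖} ×ˢ Metric.ball (0 : ℂ) ρ :=
    fun p s hp hs => ⟨hp, by simpa using hs⟩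
  obtain ⟨C, hC⟩ := hcpt.exists_bound_of_continuousOn (f := A) (hA.continuousOn.mono (by
    rintro ⟨p, s⟩ ⟨hp, hs⟩
    simp only [mem_sphere_zero_iff_norm, mem_closedBall_zero_iff] at hp hs
    exact hmem p s hp.ge (by linarith)))
  have hC0 : 0 ≤ C := (norm_nonneg _).trans (hC (1, 0) ⟨by simp, by simp; linarith⟩)
  have hdecay : ∀ p s : ℂ, 1 ≤ ‖p‖ → ‖s‖ ≤ ρ / 2 → ‖A (p, s)‖ ≤ C / ‖p‖ := fun p s hp hs' => by
    refine norm_le_div_of_expansion (A := fun p => A (p, s)) (a := fun n => a n s) ?_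
      (fun q hq => hs q s hq (by linarith))
      (fun q hq => hC _ ⟨by simpa using hq, by simpa using hs'⟩) hp
    intro q hq
    exact AnalyticAt.fun_comp (g := A) (f := fun q => (q, s)) (hA _ (hmem q s hq (by linarith)))
      (analyticAt_id.prod analyticAt_const)
  -- Cauchy's estimate on the discs of radius `1` in `p` and `ρ / 4` in `s`, on which `A = O(1/p)`
  refine ⟨max (2 * C) (C / (ρ / 4)), le_max_of_le_left (by positivity), fun p s hp hs' => ?_⟩
  have hp0 : 0 < ‖p‖ := by linarith
  have hd : DifferentiableAt ℂ A (p, s) :=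
    (hA _ (hmem p s (by linarith) (by linarith))).differentiableAt
  constructor
  · have h1 : HasDerivAt (fun q : ℂ => (q, s)) ((1 : ℂ), (0 : ℂ)) p :=
      (hasDerivAt_id _).prodMk (hasDerivAt_const _ _)
    rw [← (hd.hasFDerivAt.comp_hasDerivAt (f := fun q => (q, s)) p h1).deriv]
    have hq1 : ∀ q ∈ Metric.closedBall p 1, ‖p‖ / 2 ≤ ‖q‖ := fun q hq => by
      have := norm_sub_norm_le p q
      rw [mem_closedBall_iff_norm'] at hq
      linarith
    have := Complex.norm_deriv_le_of_forall_mem_sphere_norm_le (f := A ∘ fun q => (q, s)) (c := p)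
      one_pos (C := C / (‖p‖ / 2)) (DifferentiableOn.diffContOnCl ?_) ?_
    · refine this.trans ?_
      rw [div_one, show C / (‖p‖ / 2) = 2 * C / ‖p‖ by field_simp]
      gcongr
      exact le_max_left _ _
    · rw [closure_ball _ one_ne_zero]
      intro q hq
      exact (DifferentiableAt.comp q (hA _ (hmem q s (by linarith [hq1 q hq])
        (by linarith))).differentiableAt (by fun_prop)).differentiableWithinAt
    · intro q hq
      have hq2 := hq1 q (Metric.sphere_subset_closedBall hq)
      refine (hdecay q s (by linarith) (by linarith)).trans ?_
      gcongr
  · have h1 : HasDerivAt (fun r : ℂ => (p, r)) ((0 : ℂ), (1 : ℂ)) s :=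
      (hasDerivAt_const _ _).prodMk (hasDerivAt_id _)
    rw [← (hd.hasFDerivAt.comp_hasDerivAt (f := fun r => (p, r)) s h1).deriv]
    have hr1 : ∀ r ∈ Metric.closedBall s (ρ / 4), ‖r‖ ≤ ρ / 2 := fun r hr => by
      have := norm_sub_norm_le r s
      rw [mem_closedBall_iff_norm] at hr
      linarith
    have := Complex.norm_deriv_le_of_forall_mem_sphere_norm_le (f := A ∘ fun r => (p, r)) (c := s)
      (R := ρ / 4) (by positivity) (C := C / ‖p‖) (DifferentiableOn.diffContOnCl ?_) ?_
    · refine this.trans ?_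
      rw [div_right_comm]
      gcongr
      exact le_max_right _ _
    · rw [closure_ball _ (by positivity)]
      intro r hr
      exact (DifferentiableAt.comp r (hA _ (hmem p r (by linarith)
        (by linarith [hr1 r hr]))).differentiableAt (by fun_prop)).differentiableWithinAt
    · intro r hr
      exact hdecay p r (by linarith) (hr1 r (Metric.sphere_subset_closedBall hr))

/-! ### The asymptotics of the bracket -/

section

variable {E : Type*} [NormedAddCommGroup E] [NormedSpace ℂ E] {τ : TimeSpace E} {α : ℂ} {k : ℕ}
  {T : Set E} {U : Set (ℂ × ℂ)} {F : ℂ × ℂ → ℂ × ℂ} {Lin Min L M : ℂ × E → ℂ}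

lemma TimeSpace.differentiable_tsum (τ : TimeSpace E) (t : E) :
    Differentiable ℂ fun z => ∑' n, τ.coord n t * z ^ n :=
  differentiable_tsum_pow (Eventually.of_forall (τ.summable_coord t))

lemma TimeSpace.tsum_slice (τ : TimeSpace E) (t : E) (s z : ℂ) :
    ∑' n, τ.coord n (t + s • τ.e₀) * z ^ n = (∑' n, τ.coord n t * z ^ n) + s := by
  have h1 := (τ.summable_coord t z).hasSum
  have h2 : HasSum (fun n : ℕ => if n = 0 then s else 0) s := hasSum_ite_eq 0 s
  suffices HasSum (fun n => τ.coord n (t + s • τ.e₀) * z ^ n)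
    ((∑' n, τ.coord n t * z ^ n) + s) from this.tsum_eq
  refine (congrArg (HasSum · _) (funext fun n => ?_)).mpr (h1.add h2)
  rcases n with _ | n <;> simp [τ.coord_e₀]

/-- With `L = p + A` and `M = S(L) + x + B`, the bracket is `(1 + A_p)(1 + B_x) - A_x B_p`: the
function `S` drops out. -/
lemma det_fderiv_of_expansion {A B : ℂ × ℂ → ℂ} {S : ℂ → ℂ} (hS : Differentiable ℂ S)
    {z : ℂ × ℂ} (hA : DifferentiableAt ℂ A z) (hB : DifferentiableAt ℂ B z) :
    (fderiv ℂ (fun y : ℂ × ℂ => (y.1 + A y, S (y.1 + A y) + y.2 + B y)) z).det =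
      (1 + fderiv ℂ A z (1, 0)) * (1 + fderiv ℂ B z (0, 1)) -
        fderiv ℂ A z (0, 1) * fderiv ℂ B z (1, 0) := by
  have h1 : HasFDerivAt (fun y : ℂ × ℂ => y.1 + A y)
      (ContinuousLinearMap.fst ℂ ℂ ℂ + fderiv ℂ A z) z := hasFDerivAt_fst.add hA.hasFDerivAt
  have h2 : HasFDerivAt (fun y : ℂ × ℂ => S (y.1 + A y))
      (deriv S (z.1 + A z) • (ContinuousLinearMap.fst ℂ ℂ ℂ + fderiv ℂ A z)) z :=
    (hS _).hasDerivAt.comp_hasFDerivAt z h1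
  have h3 := h1.prodMk ((h2.add hasFDerivAt_snd).add hB.hasFDerivAt)
  have h4 := h3.fderiv
  simp only [Pi.add_def] at h4
  rw [h4, det_eq_cross]
  simp [cross]
  ring

namespace IsRiemannSolution

/-- `{L, M} = 1 + O(1/p)`, uniformly in `x` near a given time. -/
lemma exists_bracket_bound (h : IsRiemannSolution τ T U F Lin Min L M) {t₀ : E} (ht₀ : t₀ ∈ T) :
    ∃ ρ : ℝ, 0 < ρ ∧ ∃ C : ℝ, ∀ p s : ℂ, 2 ≤ ‖p‖ → ‖s‖ < ρ →
      ‖bracket τ L M (p, t₀ + s • τ.e₀) - 1‖ ≤ C / ‖p‖ := by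
  obtain ⟨ρ, hρ, hT⟩ := Metric.eventually_nhds_iff_ball.1 (h.eventually_slice_mem ht₀)
  obtain ⟨u, v, huv⟩ := h.expansions
  set S : ℂ → ℂ := fun z => ∑' n, τ.coord n t₀ * z ^ n with hSdef
  have hS : Differentiable ℂ S := τ.differentiable_tsum t₀
  have hSa : ∀ z, AnalyticAt ℂ S z := fun z => hS.analyticAt z
  set O : Set (ℂ × ℂ) := {p : ℂ | 1 ≤ ‖p‖} ×ˢ Metric.ball 0 ρ with hO
  have hL : AnalyticOnNhd ℂ (L ∘ slice τ t₀) O := fun z hz =>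
    AnalyticAt.comp (h.analytic_L _ ⟨hz.1, hT _ hz.2⟩) (analyticAt_slice τ t₀ z)
  have hM : AnalyticOnNhd ℂ (M ∘ slice τ t₀) O := fun z hz =>
    AnalyticAt.comp (h.analytic_M _ ⟨hz.1, hT _ hz.2⟩) (analyticAt_slice τ t₀ z)
  set A : ℂ × ℂ → ℂ := fun z => (L ∘ slice τ t₀) z - z.1 with hAdef
  set B : ℂ × ℂ → ℂ := fun z => (M ∘ slice τ t₀) z - S ((L ∘ slice τ t₀) z) - z.2 with hBdef
  have hA : AnalyticOnNhd ℂ A O := fun z hz => (hL z hz).sub analyticAt_fst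
  have hB : AnalyticOnNhd ℂ B O := fun z hz =>
    ((hM z hz).sub ((hSa _).fun_comp (hL z hz))).sub analyticAt_snd
  obtain ⟨C₁, hC₁, hA'⟩ := norm_fderiv_le_of_expansion hρ hA
    (a := fun n s => u n (t₀ + s • τ.e₀))
    fun p s hp hs => (huv _ (hT s (by simpa using hs)) p hp).1
  obtain ⟨C₂, hC₂, hB'⟩ := norm_fderiv_le_of_expansion hρ hB
    (a := fun n s => v n (t₀ + s • τ.e₀))
    fun p s hp hs => by
      have := (huv _ (hT s (by simpa using hs)) p hp).2
      rwa [τ.tsum_slice, ← sub_sub] at this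
  refine ⟨ρ / 4, by positivity, C₁ + C₂ + C₁ * C₂ + C₁ * C₂, fun p s hp hs => ?_⟩
  have hmem : (p, s) ∈ O := ⟨show 1 ≤ ‖p‖ by linarith, by simp; linarith⟩
  have hJ : bracket τ L M (p, t₀ + s • τ.e₀) =
      (1 + fderiv ℂ A (p, s) (1, 0)) * (1 + fderiv ℂ B (p, s) (0, 1)) -
        fderiv ℂ A (p, s) (0, 1) * fderiv ℂ B (p, s) (1, 0) := by
    rw [← det_fderiv_of_expansion hS (hA _ hmem).differentiableAt (hB _ hmem).differentiableAt]
    refine (det_fderiv_slice τ t₀ (z := (p, s)) (h.analyticAt_out (p := p) hmem.1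
      (hT s hmem.2)).differentiableAt).symm.trans ?_
    congr 2
    ext y <;> simp [hAdef, hBdef]
  obtain ⟨hA1, hA2⟩ := hA' p s hp hs
  obtain ⟨hB1, hB2⟩ := hB' p s hp hs
  rw [hJ]
  generalize fderiv ℂ A (p, s) (1, 0) = a₁ at *
  generalize fderiv ℂ A (p, s) (0, 1) = a₂ at *
  generalize fderiv ℂ B (p, s) (1, 0) = b₁ at *
  generalize fderiv ℂ B (p, s) (0, 1) = b₂ at *
  have hp0 : 0 < ‖p‖ := by linarith
  have hprod : ∀ {a b : ℂ}, ‖a‖ ≤ C₁ / ‖p‖ → ‖b‖ ≤ C₂ / ‖p‖ → ‖a * b‖ ≤ C₁ * C₂ / ‖p‖ :=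
    fun {a b} ha hb => by
      rw [norm_mul, mul_div_assoc]
      refine mul_le_mul (ha.trans ?_) hb (norm_nonneg _) hC₁
      exact div_le_self hC₁ (by linarith)
  calc ‖(1 + a₁) * (1 + b₂) - a₂ * b₁ - 1‖ = ‖a₁ + b₂ + a₁ * b₂ - a₂ * b₁‖ := by congr 1; ring
    _ ≤ ‖a₁‖ + ‖b₂‖ + ‖a₁ * b₂‖ + ‖a₂ * b₁‖ := (norm_sub_le _ _).trans
        (add_le_add_left ((norm_add_le _ _).trans (add_le_add_left (norm_add_le _ _) _)) _)
    _ ≤ C₁ / ‖p‖ + C₂ / ‖p‖ + C₁ * C₂ / ‖p‖ + C₁ * C₂ / ‖p‖ := by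
        gcongr
        · exact hprod hA1 hB2
        · exact hprod hA2 hB1
    _ = _ := by ring

lemma tendsto_bracket (h : IsRiemannSolution τ T U F Lin Min L M) {t : E} (ht : t ∈ T) :
    Tendsto (fun p => bracket τ L M (p, t)) (Bornology.cobounded ℂ) (𝓝 1) := by
  obtain ⟨ρ, hρ, C, hC⟩ := h.exists_bracket_bound ht
  rw [tendsto_iff_norm_sub_tendsto_zero]
  refine squeeze_zero' (Eventually.of_forall fun p => norm_nonneg _) ?_
    (tendsto_norm_cobounded_atTop.const_div_atTop C)
  filter_upwards [tendsto_norm_cobounded_atTop.eventually_ge_atTop 2] with p hp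
  simpa using hC p 0 hp (by simpa using hρ)

/-- Up to terms which vanish at infinity, `ln {L, M} - α Lᵏ` is a polynomial. -/
lemma exists_polynomial (h : IsRiemannSolution τ T U F Lin Min L M) (α : ℂ) (k : ℕ) {t : E}
    (ht : t ∈ T) : ∃ P : Polynomial ℂ, P.natDegree ≤ k ∧
      Tendsto (fun p => Complex.log (bracket τ L M (p, t)) - α * L (p, t) ^ k - P.eval p)
        (Bornology.cobounded ℂ) (𝓝 0) := by
  obtain ⟨u, v, huv⟩ := h.expansions
  obtain ⟨ψ, hψ, hAψ⟩ := exists_analytic_of_expansion (A := fun p => L (p, t) - p)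
    (a := fun n => u n t) (fun p hp => (AnalyticAt.fun_comp (g := L) (f := fun p => (p, t))
      (h.analytic_L (p, t) ⟨hp, ht⟩) (analyticAt_id.prod analyticAt_const)).sub analyticAt_id)
    fun p hp => (huv t ht p hp).1
  have hψ0 : AnalyticAt ℂ ψ 0 := hψ 0 (by simp)
  obtain ⟨Q, hQ, hlim⟩ := exists_polynomial_part k
    (ψ := fun q => (1 + q ^ 2 * ψ q) ^ k)
    ((analyticAt_const.add ((analyticAt_id.pow 2).mul hψ0)).pow k)
  refine ⟨Polynomial.C (-α) * Q, (Polynomial.natDegree_C_mul_le _ _).trans hQ, ?_⟩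
  have hlog : Tendsto (fun p => Complex.log (bracket τ L M (p, t)))
      (Bornology.cobounded ℂ) (𝓝 0) := by
    rw [← Complex.log_one]
    exact (h.tendsto_bracket ht).clog Complex.one_mem_slitPlane
  have := hlog.sub (hlim.const_mul α)
  rw [mul_zero, sub_zero] at this
  refine this.congr' ?_
  filter_upwards [tendsto_norm_cobounded_atTop.eventually_ge_atTop 1] with p hp
  have hp0 : p ≠ 0 := norm_pos_iff.1 (by linarith)
  have hL : L (p, t) = p * (1 + p⁻¹ ^ 2 * ψ p⁻¹) := by
    have := hAψ p hp
    rw [sub_eq_iff_eq_add] at this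
    rw [this]
    field_simp
    ring
  rw [hL, mul_pow]
  simp only [Polynomial.eval_mul, Polynomial.eval_C]
  ring

end IsRiemannSolution

end

/-! ### The reduction as the analyticity of `e^{-α Lᵏ} {L, M}` -/

lemma isPreconnected_le_norm {r : ℝ} (hr : 0 < r) : IsPreconnected {p : ℂ | r ≤ ‖p‖} := by
  have h1 : IsPreconnected (Complex.exp '' {w : ℂ | Real.log r ≤ w.re}) :=
    (convex_halfSpace_re_ge _).isPreconnected.image _ Complex.continuous_exp.continuousOn
  convert h1 using 1
  ext p
  constructor
  · intro hp
    have hp0 : p ≠ 0 := norm_pos_iff.1 (hr.trans_le hp)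
    refine ⟨Complex.log p, ?_, Complex.exp_log hp0⟩
    simpa [Complex.log_re] using Real.log_le_log hr hp
  · rintro ⟨w, hw, rfl⟩
    rw [Set.mem_ofPred_eq, Complex.norm_exp, ← Real.exp_log hr]
    exact Real.exp_le_exp.2 hw

/-- Two functions which are analytic in `r ≤ |p| < ∞` and agree near infinity are equal. -/
lemma eq_of_eventuallyEq_cobounded {f g : ℂ → ℂ} {r : ℝ} (hr : 0 < r)
    (hf : AnalyticOnNhd ℂ f {p | r ≤ ‖p‖}) (hg : AnalyticOnNhd ℂ g {p | r ≤ ‖p‖})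
    (h : ∀ᶠ p in Bornology.cobounded ℂ, f p = g p) {p : ℂ} (hp : r ≤ ‖p‖) : f p = g p := by
  rw [(Metric.hasBasis_cobounded_compl_closedBall (0 : ℂ)).eventually_iff] at h
  obtain ⟨R, -, hR⟩ := h
  obtain ⟨q, hq1, hq2⟩ : ∃ q : ℂ, r ≤ ‖q‖ ∧ R < ‖q‖ := by
    refine ⟨((max r (R + 1) : ℝ) : ℂ), ?_, ?_⟩ <;>
      rw [Complex.norm_real, Real.norm_of_nonneg (hr.le.trans (le_max_left _ _))]
    · exact le_max_left _ _
    · exact (lt_add_one R).trans_le (le_max_right _ _)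
  refine hf.eqOn_of_preconnected_of_eventuallyEq hg (isPreconnected_le_norm hr) hq1 ?_ hp
  filter_upwards [Metric.isClosed_closedBall.isOpen_compl.mem_nhds
    (show q ∈ (Metric.closedBall (0 : ℂ) R)ᶜ by simpa using hq2)] with z hz using hR hz

/-- Functions analytic inside and outside the unit circle which agree on it define an entire
function. -/
lemma exists_entire_of_eq_on_circle {f g : ℂ → ℂ} (hf : AnalyticOnNhd ℂ f {p | ‖p‖ ≤ 1})
    (hg : AnalyticOnNhd ℂ g {p | 1 ≤ ‖p‖}) (h : ∀ p, ‖p‖ = 1 → f p = g p) :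
    ∃ G : ℂ → ℂ, Differentiable ℂ G ∧ ∀ p, 1 ≤ ‖p‖ → G p = g p := by
  classical
  set G : ℂ → ℂ := fun p => if ‖p‖ < 1 then f p else g p with hG
  refine ⟨G, fun p => ?_, fun p hp => by simp [hG, not_lt.2 hp]⟩
  rcases lt_trichotomy ‖p‖ 1 with hp | hp | hp
  · refine ((hf p hp.le).congr ?_).differentiableAt
    filter_upwards [(isOpen_lt continuous_norm continuous_const).mem_nhds hp] with q hq
    exact (if_pos hq).symm
  · refine ((hg p hp.ge).congr ?_).differentiableAt
    filter_upwards [eventuallyEq_of_eq_on_circle hp (hf p hp.le) (hg p hp.ge) h] with q hq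
    simp only [hG]
    split_ifs
    exacts [hq.symm, rfl]
  · refine ((hg p hp.le).congr ?_).differentiableAt
    filter_upwards [(isOpen_lt continuous_const continuous_norm).mem_nhds hp] with q hq
    exact (if_neg (not_lt.2 (le_of_lt hq))).symm

section

variable {E : Type*} [NormedAddCommGroup E] [NormedSpace ℂ E] {τ : TimeSpace E} {α : ℂ} {k : ℕ}
  {T : Set E} {U : Set (ℂ × ℂ)} {F : ℂ × ℂ → ℂ × ℂ} {Lin Min L M : ℂ × E → ℂ}

namespace IsRiemannSolution

lemma analyticAt_form_out (h : IsRiemannSolution τ T U F Lin Min L M) (α : ℂ) (k : ℕ)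
    {z : ℂ × E} (hz : 1 ≤ ‖z.1‖) (ht : z.2 ∈ T) :
    AnalyticAt ℂ (fun y => Complex.exp (-(α * L y ^ k)) * bracket τ L M y) z :=
  (analyticAt_exp_neg_mul_pow α k (h.analytic_L z ⟨hz, ht⟩)).mul
    (analyticAt_bracket τ (h.analytic_L z ⟨hz, ht⟩) (h.analytic_M z ⟨hz, ht⟩))

lemma analyticAt_form_in (h : IsRiemannSolution τ T U F Lin Min L M) (α : ℂ) (k : ℕ)
    {z : ℂ × E} (hz : ‖z.1‖ ≤ 1) (ht : z.2 ∈ T) :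
    AnalyticAt ℂ (fun y => Complex.exp (-(α * Lin y ^ k)) * bracket τ Lin Min y) z :=
  (analyticAt_exp_neg_mul_pow α k (h.analytic_Lin z ⟨hz, ht⟩)).mul
    (analyticAt_bracket τ (h.analytic_Lin z ⟨hz, ht⟩) (h.analytic_Min z ⟨hz, ht⟩))

lemma eventually_exp_eq (h : IsRiemannSolution τ T U F Lin Min L M) (α : ℂ) (k : ℕ) {t : E}
    (ht : t ∈ T) : ∀ᶠ p in Bornology.cobounded ℂ,
      Complex.exp (Complex.log (bracket τ L M (p, t)) - α * L (p, t) ^ k) =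
        Complex.exp (-(α * L (p, t) ^ k)) * bracket τ L M (p, t) := by
  filter_upwards [(h.tendsto_bracket ht).eventually_ne one_ne_zero] with p hp
  rw [sub_eq_add_neg, Complex.exp_add, Complex.exp_log hp, mul_comm]

/-- If `e^{-α Lᵏ} {L, M}` is analytic in the whole plane, then it is equal to `e^P`, where `P` is
the polynomial part of `ln {L, M} - α Lᵏ`, since the quotient is entire and tends to `1`. -/
theorem satisfiesReduction_of_matches (h : IsRiemannSolution τ T U F Lin Min L M)
    (hm : MatchesOnCircle τ α k T Lin Min L M) {t : E} (ht : t ∈ T) :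
    SatisfiesReduction τ α k L M t := by
  obtain ⟨P, -, hP⟩ := h.exists_polynomial α k ht
  rw [SatisfiesReduction, minusPartVanishes_iff hP]
  obtain ⟨G, hG, hGout⟩ := exists_entire_of_eq_on_circle
    (f := fun p => Complex.exp (-(α * Lin (p, t) ^ k)) * bracket τ Lin Min (p, t))
    (g := fun p => Complex.exp (-(α * L (p, t) ^ k)) * bracket τ L M (p, t))
    (fun p hp => AnalyticAt.fun_comp (f := fun p => (p, t))
      (h.analyticAt_form_in α k (z := (p, t)) hp ht) (analyticAt_id.prod analyticAt_const))
    (fun p hp => AnalyticAt.fun_comp (f := fun p => (p, t))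
      (h.analyticAt_form_out α k (z := (p, t)) hp ht) (analyticAt_id.prod analyticAt_const))
    fun p hp => hm p hp t ht
  have hd : Differentiable ℂ fun p => G p * Complex.exp (-P.eval p) :=
    hG.mul P.differentiable.neg.cexp
  have heq : ∀ᶠ p in Bornology.cobounded ℂ, G p * Complex.exp (-P.eval p) =
      Complex.exp (Complex.log (bracket τ L M (p, t)) - α * L (p, t) ^ k - P.eval p) := by
    filter_upwards [h.eventually_exp_eq α k ht,
      tendsto_norm_cobounded_atTop.eventually_ge_atTop 1] with p hp hp1
    rw [hGout p hp1, sub_eq_add_neg _ (P.eval p), Complex.exp_add, hp]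
  have hlim : Tendsto (fun p => G p * Complex.exp (-P.eval p)) (cocompact ℂ) (𝓝 1) := by
    rw [← Metric.cobounded_eq_cocompact, ← Complex.exp_zero]
    exact hP.cexp.congr' (heq.mono fun p hp => hp.symm)
  filter_upwards [heq, hP.eventually (Metric.ball_mem_nhds 0 one_pos)] with p hp hsmall
  rw [hd.apply_eq_of_tendsto_cocompact p hlim] at hp
  rw [dist_zero_right] at hsmall
  -- a number of modulus less than `1` with exponential `1` is zero
  have him := (Complex.abs_im_le_norm _).trans_lt hsmall
  have hpi := Real.pi_gt_three
  rw [abs_lt] at him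
  have hlog := Complex.log_exp (by linarith) (by linarith)
  rw [← hp, Complex.log_one] at hlog
  exact sub_eq_zero.1 hlog.symm

theorem satisfiesReduction_of_dressingCondition (h : IsRiemannSolution τ T U F Lin Min L M)
    (hD : DressingCondition α k F U) {t : E} (ht : t ∈ T) : SatisfiesReduction τ α k L M t :=
  h.satisfiesReduction_of_matches
    (h.matches_of_dressingCondition h.isLocalDiff.isOpen subset_rfl h.mem_domain hD) ht

lemma exp_polynomial_of_satisfiesReduction (h : IsRiemannSolution τ T U F Lin Min L M) {t : E}
    (ht : t ∈ T) {P : Polynomial ℂ} (hP : ∀ᶠ p in Bornology.cobounded ℂ,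
      Complex.log (bracket τ L M (p, t)) - α * L (p, t) ^ k = P.eval p) {p : ℂ} (hp : 1 ≤ ‖p‖) :
    Complex.exp (-(α * L (p, t) ^ k)) * bracket τ L M (p, t) = Complex.exp (P.eval p) := by
  refine eq_of_eventuallyEq_cobounded one_pos
    (f := fun p => Complex.exp (-(α * L (p, t) ^ k)) * bracket τ L M (p, t))
    (g := fun p => Complex.exp (P.eval p))
    (fun p hp => AnalyticAt.fun_comp (f := fun p => (p, t))
      (h.analyticAt_form_out α k (z := (p, t)) hp ht) (analyticAt_id.prod analyticAt_const))
    (fun p _ => (P.differentiable.cexp).analyticAt p) ?_ hp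
  filter_upwards [h.eventually_exp_eq α k ht, hP] with q hq1 hq2
  rw [← hq1, hq2]

/-- In a reduced solution `e^{-α Lᵏ} {L, M}` is the exponential of a polynomial in `p` whose
coefficients depend analytically on `x`: the polynomial is interpolated from its values
`ln {L, M} - α Lᵏ` at `k + 1` points near infinity. -/
theorem exists_exp_eq_form (h : IsRiemannSolution τ T U F Lin Min L M) {t₀ : E} (ht₀ : t₀ ∈ T)
    (hred : ∀ᶠ t in 𝓝 t₀, SatisfiesReduction τ α k L M t) :
    ∃ ρ : ℝ, 0 < ρ ∧ (∀ s ∈ Metric.ball (0 : ℂ) ρ, t₀ + s • τ.e₀ ∈ T) ∧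
      ∃ P : ℂ × ℂ → ℂ, AnalyticOnNhd ℂ P (Set.univ ×ˢ Metric.ball 0 ρ) ∧
        ∀ p s : ℂ, 1 ≤ ‖p‖ → ‖s‖ < ρ →
          Complex.exp (-(α * L (p, t₀ + s • τ.e₀) ^ k)) * bracket τ L M (p, t₀ + s • τ.e₀) =
            Complex.exp (P (p, s)) := by
  obtain ⟨ρ₁, hρ₁, C, hC⟩ := h.exists_bracket_bound ht₀
  have hc : Continuous fun s : ℂ => t₀ + s • τ.e₀ := by fun_prop
  have hred' : ∀ᶠ s : ℂ in 𝓝 0, SatisfiesReduction τ α k L M (t₀ + s • τ.e₀) :=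
    hc.continuousAt.eventually (by simpa using hred)
  obtain ⟨ρ₂, hρ₂, hall⟩ := Metric.eventually_nhds_iff_ball.1
    ((h.eventually_slice_mem ht₀).and hred')
  set ρ := min ρ₁ ρ₂ with hρ
  have hρ0 : 0 < ρ := lt_min hρ₁ hρ₂
  have hT : ∀ s ∈ Metric.ball (0 : ℂ) ρ, t₀ + s • τ.e₀ ∈ T := fun s hs =>
    (hall s (Metric.ball_subset_ball (min_le_right _ _) hs)).1
  -- for `|p| ≥ R` the bracket is in the disc of radius `1` about `1`, where `log` is analytic
  set R : ℝ := max 2 (|C| + 1) with hR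
  have hR2 : 2 ≤ R := le_max_left _ _
  have hslit : ∀ p s : ℂ, R ≤ ‖p‖ → ‖s‖ < ρ →
      bracket τ L M (p, t₀ + s • τ.e₀) ∈ Complex.slitPlane := fun p s hp hs => by
    refine Complex.mem_slitPlane_of_norm_lt_one (z := _ - 1) ?_ |> fun h => by simpa using h
    refine (hC p s (by linarith) (hs.trans_le (min_le_left _ _))).trans_lt ?_
    rw [div_lt_one (by linarith)]
    have := le_max_right 2 (|C| + 1)
    linarith [le_abs_self C]
  set g : ℂ × ℂ → ℂ := fun z => Complex.log (bracket τ L M (slice τ t₀ z)) -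
    α * L (slice τ t₀ z) ^ k with hg
  have hga : ∀ p s : ℂ, R ≤ ‖p‖ → ‖s‖ < ρ → AnalyticAt ℂ g (p, s) := fun p s hp hs => by
    have hmem : slice τ t₀ (p, s) ∈ {p : ℂ | 1 ≤ ‖p‖} ×ˢ T :=
      ⟨show 1 ≤ ‖p‖ by linarith, hT s (by simpa using hs)⟩
    have hL := h.analytic_L _ hmem
    have hJ := analyticAt_bracket τ hL (h.analytic_M _ hmem)
    exact ((hJ.fun_comp (analyticAt_slice τ t₀ _)).clog (hslit p s hp hs)).sub
      (analyticAt_const.mul ((hL.fun_comp (analyticAt_slice τ t₀ _)).pow k))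
  set v : ℕ → ℂ := fun j => ((R + j : ℝ) : ℂ) with hv
  have hvR : ∀ j, R ≤ ‖v j‖ := fun j => by
    rw [hv, Complex.norm_real, Real.norm_of_nonneg (by positivity)]
    simp
  have hvinj : Set.InjOn v (Finset.range (k + 1)) := fun i _ j _ hij => by simpa [hv] using hij
  refine ⟨ρ, hρ0, hT, fun z => ∑ j ∈ Finset.range (k + 1),
    g (v j, z.2) * (Lagrange.basis (Finset.range (k + 1)) v j).eval z.1, ?_, ?_⟩
  · rintro ⟨p, s⟩ ⟨-, hs⟩
    refine Finset.analyticAt_fun_sum _ fun j _ => ?_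
    refine AnalyticAt.mul ?_ ?_
    · exact AnalyticAt.fun_comp (g := g) (f := fun z : ℂ × ℂ => (v j, z.2))
        (hga _ _ (hvR j) (by simpa using hs)) (analyticAt_const.prod analyticAt_snd)
    · exact ((Polynomial.differentiable _).analyticAt _).fun_comp analyticAt_fst
  · intro p s hp hs
    have hsb : s ∈ Metric.ball (0 : ℂ) ρ := by simpa using hs
    obtain ⟨P, hdeg, hP⟩ := h.exists_polynomial α k (hT s hsb)
    have hev := (minusPartVanishes_iff hP).1
      (hall s (Metric.ball_subset_ball (min_le_right _ _) hsb)).2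
    rw [h.exp_polynomial_of_satisfiesReduction (hT s hsb) hev hp]
    congr 1
    -- the reduction gives `g = P` near infinity only, and the identity theorem up to `|p| = R`
    have hval : ∀ j, P.eval (v j) = g (v j, s) := fun j =>
      (eq_of_eventuallyEq_cobounded (r := R) (by linarith) (f := fun p => g (p, s))
        (fun q hq => AnalyticAt.fun_comp (g := g) (f := fun p => (p, s)) (hga q s hq hs)
          (analyticAt_id.prod analyticAt_const))
        (fun q _ => P.differentiable.analyticAt q) hev (hvR j)).symm
    conv_lhs => rw [Lagrange.eq_interpolate hvinj (f := P) (by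
      rw [Finset.card_range]
      exact (Polynomial.degree_le_natDegree).trans_lt (by exact_mod_cast Nat.lt_succ_of_le hdeg))]
    simp [Lagrange.interpolate_apply, Polynomial.eval_finsetSum, hval]

end IsRiemannSolution

end

/-! ### An analytic primitive in one of two variables -/

open scoped ENNReal NNReal in
/-- The mean of an analytic function over the segments `{z.1} × [0, z.2]` is analytic: its power
series is the mean of the power series composed with the contractions `(p, s) ↦ (p, θ s)`. -/
lemma analyticAt_integral_segment {f : ℂ × ℂ → ℂ} {p₀ : ℂ} (hf : AnalyticAt ℂ f (p₀, 0)) :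
    AnalyticAt ℂ (fun z : ℂ × ℂ => ∫ θ in (0 : ℝ)..1, f (z.1, θ * z.2)) (p₀, 0) := by
  obtain ⟨q, r, hq⟩ := hf
  obtain ⟨r', hr'0, hr'⟩ := ENNReal.lt_iff_exists_nnreal_btwn.1 hq.r_pos
  set Tθ : ℝ → (ℂ × ℂ →L[ℂ] ℂ × ℂ) := fun θ =>
    (ContinuousLinearMap.fst ℂ ℂ ℂ).prod ((θ : ℂ) • ContinuousLinearMap.snd ℂ ℂ ℂ) with hTθ
  have hTapp : ∀ θ y, Tθ θ y = (y.1, θ * y.2) := fun θ y => by simp [hTθ]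
  have hTc : Continuous Tθ := by
    have : Tθ = fun θ : ℝ => (ContinuousLinearMap.inl ℂ ℂ ℂ).comp (ContinuousLinearMap.fst ℂ ℂ ℂ) +
        (θ : ℂ) • (ContinuousLinearMap.inr ℂ ℂ ℂ).comp (ContinuousLinearMap.snd ℂ ℂ ℂ) := by
      funext θ
      ext <;> simp [hTθ]
    rw [this]
    fun_prop
  have hTn : ∀ θ ∈ Set.uIoc (0 : ℝ) 1, ∀ y, ‖Tθ θ y‖ ≤ ‖y‖ := fun θ hθ y => by
    rw [Set.uIoc_of_le zero_le_one] at hθ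
    rw [hTapp, Prod.norm_def, Prod.norm_def]
    refine max_le_max le_rfl ?_
    rw [norm_mul, Complex.norm_real, Real.norm_of_nonneg hθ.1.le]
    exact mul_le_of_le_one_left (norm_nonneg _) hθ.2
  have hTn1 : ∀ θ ∈ Set.uIoc (0 : ℝ) 1, ‖Tθ θ‖ ≤ 1 := fun θ hθ =>
    ContinuousLinearMap.opNorm_le_bound _ zero_le_one fun y => by simpa using hTn θ hθ y
  set Q : ℝ → ∀ n, ContinuousMultilinearMap ℂ (fun _ : Fin n => ℂ × ℂ) ℂ := fun θ n =>
    (q n).compContinuousLinearMap fun _ => Tθ θ with hQ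
  have hQc : ∀ n, Continuous fun θ => Q θ n := fun n => by
    have h1 : Continuous fun θ => fun _ : Fin n => Tθ θ := continuous_pi fun _ => hTc
    exact ((ContinuousMultilinearMap.compContinuousLinearMapContinuousMultilinear ℂ
      (fun _ : Fin n => ℂ × ℂ) (fun _ : Fin n => ℂ × ℂ) ℂ).cont.comp h1).clm_apply continuous_const
  have hQn : ∀ n, ∀ θ ∈ Set.uIoc (0 : ℝ) 1, ‖Q θ n‖ ≤ ‖q n‖ := fun n θ hθ => by
    refine ((q n).norm_compContinuousLinearMap_le _).trans ?_
    refine mul_le_of_le_one_right (norm_nonneg _) ?_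
    exact Finset.prod_le_one (fun _ _ => norm_nonneg _) fun _ _ => hTn1 θ hθ
  set I : FormalMultilinearSeries ℂ (ℂ × ℂ) ℂ := fun n => ∫ θ in (0 : ℝ)..1, Q θ n with hI
  have hIn : ∀ n, ‖I n‖ ≤ ‖q n‖ := fun n => by
    simpa using intervalIntegral.norm_integral_le_of_norm_le_const (hQn n)
  have hsumm := q.summable_norm_mul_pow (hr'.trans_le hq.r_le)
  refine ⟨I, r', ?_, by simpa using hr'0, fun {y} hy => ?_⟩
  · obtain ⟨C, -, hC⟩ := q.norm_mul_pow_le_of_lt_radius (hr'.trans_le hq.r_le)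
    exact I.le_radius_of_bound C fun n =>
      (mul_le_mul_of_nonneg_right (hIn n) (by positivity)).trans (hC n)
  · have hy' : ‖y‖ ≤ r' := by
      have : ‖y‖ < r' := by simpa using hy
      exact this.le
    have hterm : ∀ n, I n (fun _ => y) = ∫ θ in (0 : ℝ)..1, q n fun _ => Tθ θ y := fun n =>
      (ContinuousLinearMap.intervalIntegral_comp_comm
        (ContinuousMultilinearMap.apply ℂ (fun _ : Fin n => ℂ × ℂ) ℂ fun _ => y)
        ((hQc n).intervalIntegrable 0 1)).symm
    simp_rw [hterm]
    refine intervalIntegral.hasSum_integral_of_dominated_convergence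
      (fun n _ => ‖q n‖ * (r' : ℝ) ^ n) (fun n => ?_) (fun n => ?_) ?_ ?_ ?_
    · exact Continuous.aestronglyMeasurable
        ((q n).cont.comp (continuous_pi fun _ => hTc.clm_apply continuous_const))
    · refine Eventually.of_forall fun θ hθ => ((q n).le_opNorm _).trans ?_
      rw [Finset.prod_const, Finset.card_univ, Fintype.card_fin]
      gcongr
      exact (hTn θ hθ y).trans hy'
    · exact Eventually.of_forall fun _ _ => hsumm
    · exact intervalIntegrable_const
    · refine Eventually.of_forall fun θ hθ => ?_
      have hmem : Tθ θ y ∈ Metric.eball (0 : ℂ × ℂ) r := by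
        have h1 : ‖Tθ θ y‖ₑ ≤ ‖y‖ₑ := enorm_le_iff_norm_le.2 (hTn θ hθ y)
        have h2 : ‖y‖ₑ < r' := by rwa [Metric.mem_eball, edist_zero_right] at hy
        simpa using (h1.trans_lt h2).trans hr'
      simpa [hTapp] using hq.hasSum hmem

lemma mul_integral_segment_eq {g Ψ : ℂ → ℂ} {ρ : ℝ} (hg : ContinuousOn g (Metric.ball 0 ρ))
    (hΨ : ∀ s ∈ Metric.ball (0 : ℂ) ρ, HasDerivAt Ψ (g s) s) {s : ℂ} (hs : s ∈ Metric.ball 0 ρ) :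
    s * ∫ θ in (0 : ℝ)..1, g (θ * s) = Ψ s - Ψ 0 := by
  rw [mem_ball_zero_iff] at hs
  have hmem : ∀ θ ∈ Set.uIcc (0 : ℝ) 1, (θ : ℂ) * s ∈ Metric.ball (0 : ℂ) ρ := fun θ hθ => by
    rw [Set.uIcc_of_le zero_le_one] at hθ
    rw [mem_ball_zero_iff, norm_mul, Complex.norm_real, Real.norm_of_nonneg hθ.1]
    exact (mul_le_of_le_one_left (norm_nonneg _) hθ.2).trans_lt hs
  have hd : ∀ θ ∈ Set.uIcc (0 : ℝ) 1,
      HasDerivAt (fun θ : ℝ => Ψ (θ * s)) (s * g (θ * s)) θ := fun θ hθ => by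
    have h1 : HasDerivAt (fun θ : ℝ => (θ : ℂ) * s) s θ := by
      simpa using (Complex.ofRealCLM.hasDerivAt (x := θ)).mul_const s
    rw [mul_comm s]
    exact (hΨ _ (hmem θ hθ)).comp θ h1
  have hc : ContinuousOn (fun θ : ℝ => s * g (θ * s)) (Set.uIcc 0 1) :=
    continuousOn_const.mul (hg.comp (by fun_prop) hmem)
  rw [← intervalIntegral.integral_const_mul,
    intervalIntegral.integral_eq_sub_of_hasDerivAt hd hc.intervalIntegrable]
  simp

/-- A primitive in the second variable, vanishing at `0` and analytic in both variables. -/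
lemma exists_primitive_snd {f : ℂ × ℂ → ℂ} {ρ : ℝ} (hρ : 0 < ρ)
    (hf : AnalyticOnNhd ℂ f (Set.univ ×ˢ Metric.ball 0 ρ)) :
    ∃ I : ℂ × ℂ → ℂ, (∀ p, AnalyticAt ℂ I (p, 0)) ∧ (∀ p, I (p, 0) = 0) ∧
      ∀ p s : ℂ, ‖s‖ < ρ → HasDerivAt (fun s => I (p, s)) (f (p, s)) s := by
  refine ⟨fun z => z.2 * ∫ θ in (0 : ℝ)..1, f (z.1, θ * z.2), fun p => ?_, fun p => by simp,
    fun p s hs => ?_⟩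
  · exact analyticAt_snd.mul (analyticAt_integral_segment (hf _ ⟨trivial, by simpa using hρ⟩))
  · have hd : DifferentiableOn ℂ (fun s => f (p, s)) (Metric.ball 0 ρ) := fun s hs =>
      (AnalyticAt.fun_comp (g := f) (f := fun s => (p, s)) (hf _ ⟨trivial, hs⟩)
        (analyticAt_const.prod analyticAt_id)).differentiableAt.differentiableWithinAt
    obtain ⟨Ψ, hΨ⟩ := hd.isExactOn_ball
    have hsb : s ∈ Metric.ball (0 : ℂ) ρ := by simpa using hs
    refine ((hΨ s hsb).sub_const (Ψ 0)).congr_of_eventuallyEq ?_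
    filter_upwards [Metric.isOpen_ball.mem_nhds hsb] with σ hσ
    exact mul_integral_segment_eq (g := fun s => f (p, s)) hd.continuousOn hΨ hσ

/-! ### The projection along the leaves -/

section

variable {E : Type*} [NormedAddCommGroup E] [NormedSpace ℂ E]

/-- Where `V` has a nonzero bracket, its level sets are transversal to the slice `t = t₀ + x e₀`.
The map `π` moves the points near a compact part of `t = t₀` along the level sets into the slice. It
is obtained by solving `V (p + a, t₀ + b e₀) = V (p, t)` for small `(a, b)`. -/
theorem exists_leaf_projection [CompleteSpace E] (τ : TimeSpace E) {V : ℂ × E → ℂ × ℂ} {D : Set ℂ}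
    (hD : IsCompact D) {t₀ : E} (hV : ∀ p ∈ D, AnalyticAt ℂ V (p, t₀))
    (hdet : ∀ p ∈ D, bracket τ (fun y => (V y).1) (fun y => (V y).2) (p, t₀) ≠ 0) :
    ∃ (π : ℂ × E → ℂ × ℂ) (O : Set (ℂ × E)), IsOpen O ∧ (∀ p ∈ D, (p, t₀) ∈ O) ∧
      AnalyticOnNhd ℂ π O ∧ (∀ z ∈ O, V (slice τ t₀ (π z)) = V z) ∧
      ∀ p ∈ D, π (p, t₀) = (p, 0) := by
  have hs0 : ∀ p, slice τ t₀ (p, 0) = (p, t₀) := fun p => by simp [slice]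
  set ℓ : (ℂ × E) × (ℂ × ℂ) →L[ℂ] ℂ × ℂ :=
    (ContinuousLinearMap.inl ℂ ℂ ℂ).comp
      ((ContinuousLinearMap.fst ℂ ℂ E).comp (ContinuousLinearMap.fst ℂ (ℂ × E) (ℂ × ℂ))) +
      ContinuousLinearMap.snd ℂ (ℂ × E) (ℂ × ℂ) with hℓ
  have hℓapp : ∀ x, ℓ x = (x.1.1, 0) + x.2 := fun x => by simp [hℓ]
  -- the equation for `(a, b)`, with the parameters `(p, t)` kept as coordinates: the derivative is
  -- triangular, and its second diagonal block is the Jacobian of `V` on the slice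
  set Ξ : (ℂ × E) × (ℂ × ℂ) → (ℂ × E) × (ℂ × ℂ) := fun x =>
    (x.1, (V ∘ slice τ t₀) (ℓ x) - V x.1) with hΞ
  set K : Set ((ℂ × E) × (ℂ × ℂ)) := (fun p => ((p, t₀), 0)) '' D with hKdef
  have hΞ0 : ∀ p, Ξ ((p, t₀), 0) = ((p, t₀), 0) := fun p => by
    simp [hΞ, hℓapp, hs0]
  have hVs : ∀ p ∈ D, AnalyticAt ℂ (V ∘ slice τ t₀) (p, 0) := fun p hp =>
    AnalyticAt.comp (by rw [hs0]; exact hV p hp) (analyticAt_slice τ t₀ _)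
  have hK : IsCompact K := hD.image (by fun_prop)
  have hΞa : AnalyticOnNhd ℂ Ξ K := by
    rintro _ ⟨p, hp, rfl⟩
    refine analyticAt_fst.prod (AnalyticAt.sub ?_ (AnalyticAt.fun_comp (g := V)
      (f := fun x : (ℂ × E) × (ℂ × ℂ) => x.1) (hV p hp) analyticAt_fst))
    exact AnalyticAt.fun_comp (by simpa [hℓapp] using hVs p hp) (ℓ.analyticAt _)
  have hΞd : ∀ x ∈ K, ∃ e : ((ℂ × E) × (ℂ × ℂ)) ≃L[ℂ] (ℂ × E) × (ℂ × ℂ),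
      (e : (ℂ × E) × (ℂ × ℂ) →L[ℂ] (ℂ × E) × (ℂ × ℂ)) = fderiv ℂ Ξ x := by
    rintro _ ⟨p, hp, rfl⟩
    have hA : (fderiv ℂ (V ∘ slice τ t₀) (p, 0)).det ≠ 0 := by
      rw [det_fderiv_slice τ t₀ (by rw [hs0]; exact (hV p hp).differentiableAt), hs0]
      exact hdet p hp
    obtain ⟨e, he⟩ := exists_equiv_of_det_ne_zero hA
    have h1 : HasFDerivAt (V ∘ slice τ t₀) (e : ℂ × ℂ →L[ℂ] ℂ × ℂ) (ℓ ((p, t₀), 0)) := by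
      rw [he]
      simpa [hℓapp] using (hVs p hp).differentiableAt.hasFDerivAt
    have h2 : HasFDerivAt (fun x : (ℂ × E) × (ℂ × ℂ) => V x.1)
        ((fderiv ℂ V (p, t₀)).comp (ContinuousLinearMap.fst ℂ (ℂ × E) (ℂ × ℂ))) ((p, t₀), 0) :=
      HasFDerivAt.comp ((p, t₀), (0 : ℂ × ℂ)) (hV p hp).differentiableAt.hasFDerivAt hasFDerivAt_fst
    have h3 : HasFDerivAt Ξ _ ((p, t₀), 0) :=
      hasFDerivAt_fst.prodMk ((h1.comp ((p, t₀), (0 : ℂ × ℂ)) ℓ.hasFDerivAt).sub h2)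
    refine ⟨(ContinuousLinearEquiv.refl ℂ (ℂ × E)).skewProd e
      ((e : ℂ × ℂ →L[ℂ] ℂ × ℂ).comp ((ContinuousLinearMap.inl ℂ ℂ ℂ).comp
        (ContinuousLinearMap.fst ℂ ℂ E)) - fderiv ℂ V (p, t₀)), ?_⟩
    rw [h3.fderiv]
    refine ContinuousLinearMap.ext fun x => ?_
    have : e ((x.1.1, 0) + x.2) = e (x.1.1, 0) + e x.2 := map_add _ _ _
    simp [hℓapp, this]
    ring
  have hinj : Set.InjOn Ξ K := by
    rintro _ ⟨p, hp, rfl⟩ _ ⟨q, hq, rfl⟩ h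
    simpa only [hΞ0] using h
  obtain ⟨N, g, hN, hKN, -, -, hopen, hg, hgl⟩ :=
    exists_inverse_near_compact hK (fun x _ => univ_mem) hΞa hΞd hinj
  refine ⟨fun z => (z.1, 0) + (g (z, 0)).2, {z | (z, (0 : ℂ × ℂ)) ∈ Ξ '' N},
    hopen.preimage (by fun_prop), fun p hp => ⟨_, hKN ⟨p, hp, rfl⟩, hΞ0 p⟩, fun z hz => ?_, ?_, ?_⟩
  · refine (analyticAt_fst.prod analyticAt_const).add (analyticAt_snd.fun_comp ?_)
    exact AnalyticAt.fun_comp (g := g) (f := fun z => (z, (0 : ℂ × ℂ))) (hg _ hz)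
      (analyticAt_id.prod analyticAt_const)
  · rintro z ⟨⟨y, a⟩, hx, hxz⟩
    obtain rfl : y = z := congrArg Prod.fst hxz
    have h2 : (V ∘ slice τ t₀) (ℓ (y, a)) - V y = 0 := congrArg Prod.snd hxz
    have h3 := hgl _ hx
    rw [hxz] at h3
    simp only [h3]
    rw [← sub_eq_zero, ← h2, hℓapp]
    rfl
  · intro p hp
    have h3 := hgl _ (hKN ⟨p, hp, rfl⟩)
    simp only [hΞ0] at h3
    simp [h3]

end

/-! ### Dressing data of a reduced solution -/

/-- If `w` and the map `(p, s) ↦ (p, I (p, s))` pull the form `e^{-α λᵏ} dλ ∧ dμ` back to the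
same form `e^P dp ∧ ds` near the circle `|p| = 1`, `s = 0`, then the map which takes one to the
other preserves the form. -/
lemma exists_dressing_data {α : ℂ} {k : ℕ} {w : ℂ × ℂ → ℂ × ℂ} {I P : ℂ × ℂ → ℂ} {ρ : ℝ}
    (hρ : 0 < ρ) (hw : ∀ p, ‖p‖ = 1 → AnalyticAt ℂ w (p, 0)) (hI : ∀ p, AnalyticAt ℂ I (p, 0))
    (hI0 : ∀ p, I (p, 0) = 0)
    (hdI : ∀ p s : ℂ, ‖s‖ < ρ → HasDerivAt (fun s => I (p, s))
      (Complex.exp (α * p ^ k) * Complex.exp (P (p, s))) s)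
    (hform : ∀ p, ‖p‖ = 1 → ∀ᶠ z in 𝓝 (p, (0 : ℂ)),
      Complex.exp (-(α * (w z).1 ^ k)) * (fderiv ℂ w z).det = Complex.exp (P z))
    (hinj : Set.InjOn (fun p => w (p, 0)) {p | ‖p‖ = 1}) :
    ∃ (N : Set (ℂ × ℂ)) (G : ℂ × ℂ → ℂ × ℂ), IsOpen N ∧ (∀ p, ‖p‖ = 1 → (p, 0) ∈ N) ∧
      IsOpen (w '' N) ∧ AnalyticOnNhd ℂ G (w '' N) ∧ Set.InjOn G (w '' N) ∧
      (∀ z ∈ w '' N, PreservesForm α k G z) ∧ ∀ x ∈ N, G (w x) = (x.1, I x) := by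
  set Φ : ℂ × ℂ → ℂ × ℂ := fun z => (z.1, I z) with hΦ
  have hdet : ∀ z : ℂ × ℂ, AnalyticAt ℂ I z → ‖z.2‖ < ρ →
      (fderiv ℂ Φ z).det = Complex.exp (α * z.1 ^ k) * Complex.exp (P z) := fun z hz hs => by
    rw [hΦ, det_fderiv_shear hz.differentiableAt, fderiv_apply_zero_one hz.differentiableAt]
    exact (hdI z.1 z.2 hs).deriv
  set K : Set (ℂ × ℂ) := Metric.sphere (0 : ℂ) 1 ×ˢ {0} with hKdef
  have hK : IsCompact K := (isCompact_sphere _ _).prod isCompact_singleton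
  have hKforall : ∀ {q : ℂ × ℂ → Prop}, (∀ p, ‖p‖ = 1 → q (p, 0)) → ∀ x ∈ K, q x := by
    rintro q h ⟨p, s⟩ ⟨hp, hs⟩
    obtain rfl : s = 0 := hs
    exact h p (by simpa using hp)
  set O : Set (ℂ × ℂ) := {z | AnalyticAt ℂ w z ∧ AnalyticAt ℂ I z ∧ ‖z.2‖ < ρ ∧
    Complex.exp (-(α * (w z).1 ^ k)) * (fderiv ℂ w z).det = Complex.exp (P z)} with hO
  have hOK : ∀ x ∈ K, O ∈ 𝓝 x := hKforall fun p hp => by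
    have h1 : ∀ᶠ z : ℂ × ℂ in 𝓝 (p, 0), ‖z.2‖ < ρ :=
      (isOpen_lt continuous_snd.norm continuous_const).mem_nhds (by simpa using hρ)
    filter_upwards [(hw p hp).eventually_analyticAt, (hI p).eventually_analyticAt, h1, hform p hp]
      with z h1 h2 h3 h4 using ⟨h1, h2, h3, h4⟩
  have hdw : ∀ z ∈ O, (fderiv ℂ w z).det ≠ 0 := fun z hz h0 => by
    have := hz.2.2.2
    rw [h0, mul_zero] at this
    exact Complex.exp_ne_zero _ this.symm
  have hdΦ : ∀ z ∈ O, (fderiv ℂ Φ z).det ≠ 0 := fun z hz => by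
    rw [hdet z hz.2.1 hz.2.2.1]
    exact mul_ne_zero (Complex.exp_ne_zero _) (Complex.exp_ne_zero _)
  have hΦa : ∀ z ∈ O, AnalyticAt ℂ Φ z := fun z hz => analyticAt_fst.prod hz.2.1
  have hKO : K ⊆ O := fun x hx => mem_of_mem_nhds (hOK x hx)
  obtain ⟨N₁, -, hN₁, hKN₁, hN₁O, hΦinj, -⟩ := exists_inverse_near_compact hK hOK
    (fun x hx => hΦa x (hKO hx)) (fun x hx => exists_equiv_of_det_ne_zero (hdΦ x (hKO hx))) (by
      rintro ⟨p, s⟩ ⟨-, hs⟩ ⟨q, r⟩ ⟨-, hr⟩ h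
      obtain rfl : s = 0 := hs
      obtain rfl : r = 0 := hr
      simpa [hΦ, hI0] using h)
  obtain ⟨N, g, hN, hKN, hNN₁, hwinj, hopen, hg, hgl⟩ := exists_inverse_near_compact hK
    (fun x hx => hN₁.mem_nhds (hKN₁ hx)) (fun x hx => (hKO hx).1)
    (fun x hx => exists_equiv_of_det_ne_zero (hdw x (hKO hx))) (by
      rintro ⟨p, s⟩ ⟨hp, hs⟩ ⟨q, r⟩ ⟨hq, hr⟩ h
      obtain rfl : s = 0 := hs
      obtain rfl : r = 0 := hr
      rw [mem_sphere_zero_iff_norm] at hp hq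
      have hpq : p = q := hinj hp hq h
      rw [hpq])
  have hNO : N ⊆ O := hNN₁.trans hN₁O
  have hGa : AnalyticOnNhd ℂ (Φ ∘ g) (w '' N) := by
    rintro _ ⟨x, hx, rfl⟩
    exact AnalyticAt.comp (by rw [hgl x hx]; exact hΦa x (hNO hx)) (hg _ ⟨x, hx, rfl⟩)
  have hGw : ∀ x ∈ N, (Φ ∘ g) (w x) = Φ x := fun x hx => by
    rw [Function.comp_apply, hgl x hx]
  refine ⟨N, Φ ∘ g, hN, fun p hp => hKN ⟨by simpa using hp, rfl⟩, hopen, hGa, ?_, ?_, hGw⟩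
  · rintro _ ⟨x, hx, rfl⟩ _ ⟨y, hy, rfl⟩ h
    rw [hGw x hx, hGw y hy] at h
    rw [hΦinj (hNN₁ hx) (hNN₁ hy) h]
  · rintro _ ⟨x, hx, rfl⟩
    have hxO := hNO hx
    have h1 : (fderiv ℂ (Φ ∘ g) (w x)).det * (fderiv ℂ w x).det =
        Complex.exp (α * x.1 ^ k) * Complex.exp (P x) := by
      rw [← hdet x hxO.2.1 hxO.2.2.1, ← det_fderiv_comp (hGa _ ⟨x, hx, rfl⟩).differentiableAt
        hxO.1.differentiableAt]
      have : (Φ ∘ g) ∘ w =ᶠ[𝓝 x] Φ := by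
        filter_upwards [hN.mem_nhds hx] with y hy using hGw y hy
      rw [this.fderiv_eq]
    refine mul_right_cancel₀ (hdw x hxO) ?_
    rw [mul_assoc, h1, hGw x hx, hxO.2.2.2, ← mul_assoc, ← Complex.exp_add]
    simp [hΦ]

section

variable {E : Type*} [NormedAddCommGroup E] [NormedSpace ℂ E] {τ : TimeSpace E} {α : ℂ} {k : ℕ}
  {T : Set E} {U : Set (ℂ × ℂ)} {F : ℂ × ℂ → ℂ × ℂ} {Lin Min L M : ℂ × E → ℂ}

namespace IsRiemannSolution

/-- The leaf projection of the inner functions is also that of the outer ones near the circle, where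
they differ by the local diffeomorphism `F`. -/
lemma eventually_out_leaf (h : IsRiemannSolution τ T U F Lin Min L M) {t₀ : E} (ht₀ : t₀ ∈ T)
    {π : ℂ × E → ℂ × ℂ} {p : ℂ} (hp : ‖p‖ = 1) (hπ : ContinuousAt π (p, t₀))
    (hπ0 : π (p, t₀) = (p, 0))
    (hleaf : ∀ᶠ z in 𝓝 (p, t₀), (Lin (slice τ t₀ (π z)), Min (slice τ t₀ (π z))) =
      (Lin z, Min z)) :
    ∀ᶠ z in 𝓝 (p, t₀), (L (slice τ t₀ (π z)), M (slice τ t₀ (π z))) = (L z, M z) := by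
  have hsπ : Tendsto (fun z => slice τ t₀ (π z)) (𝓝 (p, t₀)) (𝓝 (p, t₀)) := by
    have h1 : ContinuousAt (fun z => slice τ t₀ (π z)) (p, t₀) :=
      (continuous_slice τ t₀).continuousAt.comp hπ
    simpa [ContinuousAt, hπ0, slice] using h1
  obtain ⟨u, hu, hFinj⟩ := injOn_nhds_of_fderiv_equiv (h.analyticAt_F hp ht₀)
    (exists_equiv_of_det_ne_zero (h.isLocalDiff.det_ne_zero _ (h.mem_domain p hp t₀ ht₀)))
  have hWu : ∀ᶠ z in 𝓝 (p, t₀), (L z, M z) ∈ u :=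
    (h.analyticAt_out hp.ge ht₀).continuousAt.eventually_mem hu
  have hj := h.eventually_jump hp ht₀
  filter_upwards [hWu, hsπ.eventually hWu, hj, hsπ.eventually hj, hleaf] with z h1 h2 h3 h4 h5
  exact hFinj h2 h1 (h4.symm.trans (h5.trans h3))

/-- A reduced solution has dressing data which satisfy the dressing condition. -/
theorem exists_dressing [CompleteSpace E] (h : IsRiemannSolution τ T U F Lin Min L M)
    (hn : NondegenerateInside τ T Lin Min) {t₀ : E} (ht₀ : t₀ ∈ T)
    (hinj : Set.InjOn (fun p : ℂ => (L (p, t₀), M (p, t₀))) {p : ℂ | ‖p‖ = 1})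
    (hred : ∀ᶠ t in 𝓝 t₀, SatisfiesReduction τ α k L M t) :
    ∃ (T' : Set E) (U' : Set (ℂ × ℂ)) (F' : ℂ × ℂ → ℂ × ℂ) (Lin' Min' : ℂ × E → ℂ),
      t₀ ∈ T' ∧ T' ⊆ T ∧ IsRiemannSolution τ T' U' F' Lin' Min' L M ∧
      NondegenerateInside τ T' Lin' Min' ∧ Set.InjOn F' U' ∧ DressingCondition α k F' U' := by
  have hs0 : ∀ p, slice τ t₀ (p, 0) = (p, t₀) := fun p => by simp [slice]
  obtain ⟨ρ, hρ, hT, P, hPa, hP⟩ := h.exists_exp_eq_form ht₀ hred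
  obtain ⟨I, hIa, hI0, hdI⟩ := exists_primitive_snd
    (f := fun z => Complex.exp (α * z.1 ^ k) * Complex.exp (P z)) hρ
    fun z hz => (analyticAt_exp_mul_pow α k analyticAt_fst).mul (hPa z hz).cexp
  set W : ℂ × E → ℂ × ℂ := fun z => (L z, M z) with hW
  set w : ℂ × ℂ → ℂ × ℂ := W ∘ slice τ t₀ with hw
  have hWa : ∀ p, ‖p‖ = 1 → AnalyticAt ℂ W (slice τ t₀ (p, 0)) := fun p hp => by
    rw [hs0]; exact h.analyticAt_out hp.ge ht₀
  have hwa : ∀ p, ‖p‖ = 1 → AnalyticAt ℂ w (p, 0) := fun p hp =>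
    AnalyticAt.comp (hWa p hp) (analyticAt_slice τ t₀ _)
  have hform : ∀ p, ‖p‖ = 1 → ∀ᶠ z in 𝓝 (p, (0 : ℂ)),
      Complex.exp (-(α * (w z).1 ^ k)) * (fderiv ℂ w z).det = Complex.exp (P z) := fun p hp => by
    have h1 : AnalyticAt ℂ (fun z => Complex.exp (-(α * L (slice τ t₀ z) ^ k)) *
        bracket τ L M (slice τ t₀ z) - Complex.exp (P z)) (p, 0) := by
      refine AnalyticAt.sub ?_ (hPa _ ⟨trivial, by simpa using hρ⟩).cexp
      refine AnalyticAt.fun_comp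
        (g := fun y => Complex.exp (-(α * L y ^ k)) * bracket τ L M y) ?_ (analyticAt_slice τ t₀ _)
      rw [hs0]
      exact h.analyticAt_form_out α k hp.ge ht₀
    have h2 := eventually_eq_zero_of_circle hp h1 (by
      filter_upwards [Metric.ball_mem_nhds (0 : ℂ) hρ] with s hs q hq
      exact sub_eq_zero.2 (hP q s hq.ge (by simpa using hs)))
    have h3 : ∀ᶠ z in 𝓝 (p, (0 : ℂ)), AnalyticAt ℂ W (slice τ t₀ z) :=
      (continuous_slice τ t₀).continuousAt.eventually (hWa p hp).eventually_analyticAt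
    filter_upwards [h2, h3] with z hz hz'
    rw [hw, det_fderiv_slice τ t₀ hz'.differentiableAt]
    exact sub_eq_zero.1 hz
  obtain ⟨N, G, hN, hKN, hopen, hGa, hGinj, hGform, hGw⟩ :=
    exists_dressing_data hρ hwa hIa hI0 hdI hform (by simpa only [hw, Function.comp_apply, hs0])
  set V : ℂ × E → ℂ × ℂ := fun z => (Lin z, Min z) with hV
  obtain ⟨π, O, hO, hDO, hπa, hπV, hπ0⟩ := exists_leaf_projection τ (V := V)
    (isCompact_closedBall (0 : ℂ) 1) (t₀ := t₀)
    (fun p hp => h.analyticAt_in (by simpa using hp) ht₀)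
    (fun p hp => hn p (by simpa using hp) t₀ ht₀)
  have hπ0' : ∀ p, ‖p‖ ≤ 1 → π (p, t₀) = (p, 0) := fun p hp => hπ0 p (by simpa using hp)
  have hDO' : ∀ p, ‖p‖ ≤ 1 → (p, t₀) ∈ O := fun p hp => hDO p (by simpa using hp)
  have hπc : ∀ p, ‖p‖ ≤ 1 → Tendsto π (𝓝 (p, t₀)) (𝓝 (p, 0)) := fun p hp => by
    rw [← hπ0' p hp]; exact (hπa _ (hDO' p hp)).continuousAt
  -- the conditions on `(p, t)` which hold for all `t` near `t₀`, uniformly on the disc and circle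
  have hdisc : ∀ᶠ t in 𝓝 t₀, ∀ p ∈ Metric.closedBall (0 : ℂ) 1, (p, t) ∈ O ∧
      AnalyticAt ℂ I (π (p, t)) ∧ ‖(π (p, t)).2‖ < ρ ∧ AnalyticAt ℂ V (slice τ t₀ (π (p, t))) := by
    refine (isCompact_closedBall _ _).eventually_forall_of_forall_eventually fun p hp => ?_
    rw [mem_closedBall_zero_iff] at hp
    have hρ' : ∀ᶠ z : ℂ × ℂ in 𝓝 (p, 0), ‖z.2‖ < ρ :=
      (isOpen_lt continuous_snd.norm continuous_const).mem_nhds (by simpa using hρ)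
    have hVs : ∀ᶠ z in 𝓝 (p, (0 : ℂ)), AnalyticAt ℂ V (slice τ t₀ z) := by
      refine (continuous_slice τ t₀).continuousAt.eventually ?_
      rw [hs0]
      exact (h.analyticAt_in hp ht₀).eventually_analyticAt
    have := Filter.Eventually.and (hO.mem_nhds (hDO' p hp)) ((hπc p hp).eventually
      ((hIa p).eventually_analyticAt.and (hρ'.and hVs)))
    exact (continuous_swap.tendsto (t₀, p)).eventually this
  have hcirc : ∀ᶠ t in 𝓝 t₀, ∀ p ∈ Metric.sphere (0 : ℂ) 1, π (p, t) ∈ N ∧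
      w (π (p, t)) = W (p, t) := by
    refine (isCompact_sphere _ _).eventually_forall_of_forall_eventually fun p hp => ?_
    rw [mem_sphere_zero_iff_norm] at hp
    have := Filter.Eventually.and ((hπc p hp.le).eventually (hN.mem_nhds (hKN p hp)))
      (h.eventually_out_leaf ht₀ hp (hπa _ (hDO' p hp.le)).continuousAt (hπ0' p hp.le)
        (Filter.mem_of_superset (hO.mem_nhds (hDO' p hp.le)) hπV))
    exact (continuous_swap.tendsto (t₀, p)).eventually this
  obtain ⟨T', hT', hT'o, ht₀'⟩ := mem_nhds_iff.1
    ((hdisc.and hcirc).and (h.isOpen_times.mem_nhds ht₀))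
  have hd' : ∀ p : ℂ, ‖p‖ ≤ 1 → ∀ t ∈ T', (p, t) ∈ O ∧ AnalyticAt ℂ I (π (p, t)) ∧
      ‖(π (p, t)).2‖ < ρ ∧ AnalyticAt ℂ V (slice τ t₀ (π (p, t))) := fun p hp t ht =>
    (hT' ht).1.1 p (by simpa using hp)
  have hc' : ∀ p : ℂ, ‖p‖ = 1 → ∀ t ∈ T', π (p, t) ∈ N ∧ w (π (p, t)) = W (p, t) :=
    fun p hp t ht => (hT' ht).1.2 p (by simpa using hp)
  have hsub : T' ⊆ T := fun t ht => (hT' ht).2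
  refine ⟨T', w '' N, G, fun z => (π z).1, fun z => I (π z), ht₀', hsub, ?_, ?_, hGinj,
    (dressingCondition_iff hopen hGa).2 hGform⟩
  · exact {
      isOpen_times := hT'o
      isLocalDiff := ⟨hopen, hGa, fun z hz h0 => by
        have := hGform z hz
        rw [PreservesForm, h0, mul_zero] at this
        exact Complex.exp_ne_zero _ this.symm⟩
      analytic_Lin := fun z hz => analyticAt_fst.fun_comp (hπa z (hd' z.1 hz.1 z.2 hz.2).1)
      analytic_Min := fun z hz =>
        (hd' z.1 hz.1 z.2 hz.2).2.1.fun_comp (hπa z (hd' z.1 hz.1 z.2 hz.2).1)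
      analytic_L := h.analytic_L.mono (Set.prod_mono le_rfl hsub)
      analytic_M := h.analytic_M.mono (Set.prod_mono le_rfl hsub)
      expansions := by
        obtain ⟨u, v, huv⟩ := h.expansions
        exact ⟨u, v, fun t ht => huv t (hsub ht)⟩
      mem_domain := fun p hp t ht => ⟨_, hc' p hp t ht⟩
      jump := fun p hp t ht => by
        obtain ⟨h1, h2⟩ := hc' p hp t ht
        exact (hGw _ h1).symm.trans (congrArg G h2) }
  · intro p hp t ht
    obtain ⟨hzO, hIz, hρz, hVz⟩ := hd' p hp t ht
    have hπd := (hπa _ hzO).differentiableAt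
    have hb : bracket τ (fun z => (π z).1) (fun z => (π z).2) (p, t) ≠ 0 := fun h0 => by
      apply hn p hp t (hsub ht)
      have hev : ∀ᶠ z in 𝓝 (p, t), V z = (V ∘ slice τ t₀) (π z) := by
        filter_upwards [hO.mem_nhds hzO] with z hz using (hπV z hz).symm
      refine (bracket_congr τ (hev.mono fun z hz => congrArg Prod.fst hz)
        (hev.mono fun z hz => congrArg Prod.snd hz)).trans ?_
      refine (bracket_comp τ (AnalyticAt.comp hVz (analyticAt_slice τ t₀ _)).differentiableAt
        hπd).trans ?_
      rw [h0, mul_zero]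
    have hΦ : AnalyticAt ℂ (fun z : ℂ × ℂ => (z.1, I z)) (π (p, t)) := analyticAt_fst.prod hIz
    have hbr := bracket_comp τ hΦ.differentiableAt hπd
    refine fun h0 => mul_ne_zero ?_ hb (hbr.symm.trans h0)
    rw [det_fderiv_shear hIz.differentiableAt, fderiv_apply_zero_one hIz.differentiableAt,
      (hdI _ _ hρz).deriv]
    exact mul_ne_zero (Complex.exp_ne_zero _) (Complex.exp_ne_zero _)

end IsRiemannSolution

end

theorem proposition2 {E : Type*} [NormedAddCommGroup E] [NormedSpace ℂ E] [CompleteSpace E]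
    (τ : TimeSpace E) (α : ℂ) (k : ℕ) (T : Set E) (U : Set (ℂ × ℂ)) (F : ℂ × ℂ → ℂ × ℂ)
    (Lin Min L M : ℂ × E → ℂ) (h : IsRiemannSolution τ T U F Lin Min L M) :
    -- dressing data with `f ∘ F ∘ f⁻¹ ∈ SDiff(2)` give reduced solutions
    (DressingCondition α k F U → ∀ t ∈ T, SatisfiesReduction τ α k L M t) ∧
    (NondegenerateInside τ T Lin Min →
      -- for given data, the condition holds near the values taken on the circle iff
      -- `e^{-α Lᵏ} {L, M}` is analytic in the whole plane
      ((∃ U' : Set (ℂ × ℂ), IsOpen U' ∧ U' ⊆ U ∧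
          (∀ p : ℂ, ‖p‖ = 1 → ∀ t ∈ T, (L (p, t), M (p, t)) ∈ U') ∧
          DressingCondition α k F U') ↔
        MatchesOnCircle τ α k T Lin Min L M) ∧
      -- the reduced solutions are exactly those which have dressing data with the condition
      (∀ t₀ ∈ T, Set.InjOn (fun p : ℂ => (L (p, t₀), M (p, t₀))) {p : ℂ | ‖p‖ = 1} →
        ((∀ᶠ t in 𝓝 t₀, SatisfiesReduction τ α k L M t) ↔
          ∃ (T' : Set E) (U' : Set (ℂ × ℂ)) (F' : ℂ × ℂ → ℂ × ℂ) (Lin' Min' : ℂ × E → ℂ),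
            t₀ ∈ T' ∧ T' ⊆ T ∧ IsRiemannSolution τ T' U' F' Lin' Min' L M ∧
            NondegenerateInside τ T' Lin' Min' ∧ Set.InjOn F' U' ∧
            DressingCondition α k F' U'))) := by
  refine ⟨fun hD t ht => h.satisfiesReduction_of_dressingCondition hD ht, fun hn =>
    ⟨h.exists_dressingCondition_iff_matches hn, fun t₀ ht₀ hinj =>
      ⟨h.exists_dressing hn ht₀ hinj, ?_⟩⟩⟩
  rintro ⟨T', U', F', Lin', Min', ht₀', -, h', -, -, hD⟩
  filter_upwards [h'.isOpen_times.mem_nhds ht₀'] with t ht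
  exact h'.satisfiesReduction_of_dressingCondition hD ht
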